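/- Setting. Let $d\ge 0$ and $\mathcal A=\{1,\dots,K\}$. Contexts $X_t\in\mathbb R^d$ and potential outcomes $(Y_t(a))_{a\in\mathcal A}$, $t\ge 1$, are such that the vectors $(X_t,(Y_t(a))_{a})$ are i.i.d. over $t$, and $(X_t,(Y_t(a))_a)$ is independent of the observed history $\mathcal H_{t-1}=(X_\tau,A_\tau,Y_\tau)_{\tau<t}$, where $Y_t=Y_t(A_t)$ is the observed outcome. The action $A_t$ is drawn from a behavior policy $\pi_t(\cdot\mid X_t,\mathcal H_{t-1})$, and given $(\mathcal H_{t-1},X_t)$ it is independent of $(Y_t(a))_a$. For $\lambda>0$ the ridge estimator is $\hat\beta_t=(\hat\beta_{t,a})_{a\in\mathcal A}$ with $$\hat\beta_{t,a}=\Bigl(\lambda I+\sum_{\tau<t}1_{\{A_\tau=a\}}X_\tau X_\tau^\top\Bigr)^{-1}\sum_{\tau<t}1_{\{A_\tau=a\}}X_\tau Y_\tau .$$ For $\beta=(\beta_a)_{a\in\mathcal A}$, the Boltzmann policy with temperature $\gamma$ is $\pi^\gamma(a\mid x,\beta)=\exp(\langle\beta_a,x\rangle/\gamma)/\sum_{b}\exp(\langle\beta_b,x\rangle/\gamma)$.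 For $\pi_{\min}\in(0,1)$ with $K\pi_{\min}\le 1$, the clipped policy is $\tilde\pi^\gamma(a\mid x,\beta)=\max\{\pi^\gamma(a\mid x,\beta)-\nu,\pi_{\min}\}$, where $\nu$ is chosen such that $\sum_a\max\{\pi^\gamma(a\mid x,\beta)-\nu,\pi_{\min}\}=1$. Assumptions. Let $M,\sigma_{\min},R_y,\sigma_\eta>0$ be such that, for all $t$: (i) $\|X_t\|_2\le M$ a.s.; (ii) $\mathbb E[X_tX_t^\top]\succeq\sigma_{\min}^2 I$; (iii) $Y_t=y(X_t,A_t)+\eta_t$ for a measurable function $y$ with $|y(x,a)|\le R_y$ for all $\|x\|_2\le M$ and $a\in\mathcal A$, where the noise satisfies $\mathbb E[\eta_t\mid \mathcal H_{t-1},X_t,A_t]=0$ and $\mathbb E[\eta_t^2]\le\sigma_\eta^2$ (as is the case for mean-zero noise $\eta_t$ with $\mathbb E[\eta_t^2]\le\sigma_\eta^2$ that is independent of $(\mathcal H_{t-1},X_t,A_t)$). Claim. Suppose that the data are collected with the behavior policy $\pi_t(\cdot\mid X_t,\mathcal H_{t-1})=\tilde\pi^\gamma(\cdot\mid X_t,\hat\beta_t)$.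 If $$\gamma\ \ge\ 2M^3\cdot\max\left\{\frac{2}{\pi_{\min}\sigma_{\min}^2},\ \frac{8\,(MR_y+4M\sigma_\eta\sqrt{dK})}{\pi_{\min}^2\sigma_{\min}^4}\right\}K(K+1),$$ then there is a deterministic vector $\bar\beta\in\mathbb R^{Kd}$ such that $\hat\beta_t\to\bar\beta$ in probability. Moreover the policy converges: there is a stationary policy $\bar\pi$, which maps each $x\in\mathbb R^d$ to a probability distribution on $\mathcal A$, such that $\tilde\pi^\gamma(a\mid X_t,\hat\beta_t)-\bar\pi(a\mid X_t)\to 0$ in probability for every $a\in\mathcal A$. -/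

import Mathlib

open MeasureTheory ProbabilityTheory Filter

namespace ContextualBandit

noncomputable section

/-- Contexts: vectors of `ℝ^d` with the Euclidean norm. -/
abbrev Context (d : ℕ) : Type := EuclideanSpace ℝ (Fin d)

/-- The observed history before a round that is preceded by `t` rounds: for each of them the
context, the chosen action and the observed outcome. (The recorded selection probabilities are
functions of these data, so they carry no further information.) -/
abbrev History (d K t : ℕ) : Type := Fin t → Context d × Fin K × ℝ

/-- A behavior policy: `π t h x a` is the probability of choosing action `a` in the round preceded
by `t` rounds, given the history `h` and the current context `x`. -/
abbrev BehaviorPolicy (d K : ℕ) : Type :=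
  (t : ℕ) → History d K t → Context d → Fin K → ℝ

/-! ### Ridge estimator and clipped Boltzmann exploration -/

/-- The regularised Gram matrix `lam * I + ∑_τ 1{A_τ = a} X_τ X_τᵀ` of action `a`. -/
def ridgeGram {d K t : ℕ} (lam : ℝ) (h : History d K t) (a : Fin K) :
    Matrix (Fin d) (Fin d) ℝ :=
  lam • (1 : Matrix (Fin d) (Fin d) ℝ) +
    ∑ τ : Fin t, if (h τ).2.1 = a then
      Matrix.vecMulVec (WithLp.ofLp (h τ).1) (WithLp.ofLp (h τ).1) else 0

/-- The cross product vector `∑_τ 1{A_τ = a} X_τ Y_τ` of action `a`. -/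
def ridgeCross {d K t : ℕ} (h : History d K t) (a : Fin K) : Fin d → ℝ :=
  ∑ τ : Fin t, if (h τ).2.1 = a then (h τ).2.2 • WithLp.ofLp (h τ).1 else 0

/-- The ridge estimator, one coefficient vector in `ℝ^d` per action. -/
def ridge {d K t : ℕ} (lam : ℝ) (h : History d K t) : Fin K → Context d :=
  fun a => WithLp.toLp 2 (Matrix.mulVec (ridgeGram lam h a)⁻¹ (ridgeCross h a))

/-- The (unclipped) Boltzmann policy with temperature `γ` for the linear working model `β`. -/
def boltzmann {d K : ℕ} (γ : ℝ) (β : Fin K → Context d) (x : Context d) : Fin K → ℝ :=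
  fun a => Real.exp (inner ℝ (β a) x / γ) / ∑ b : Fin K, Real.exp (inner ℝ (β b) x / γ)

/-- A shift `ν` with `∑_a max (p a - ν) πmin = 1`; see `exists_shift` and `shift_unique`. -/
def clipShift {K : ℕ} (πmin : ℝ) (p : Fin K → ℝ) : ℝ :=
  Classical.epsilon fun ν : ℝ => ∑ a, max (p a - ν) πmin = 1

/-- The clipping map, `Clip(p)_a = max (p_a - ν(p)) πmin`. -/
def clip {K : ℕ} (πmin : ℝ) (p : Fin K → ℝ) : Fin K → ℝ :=
  fun a => max (p a - clipShift πmin p) πmin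

/-- The shift in the clipping map exists when `K * πmin ≤ 1`. -/
theorem exists_shift {K : ℕ} {πmin : ℝ} (hK : (K : ℝ) * πmin ≤ 1) {p : Fin K → ℝ}
    (hp : p ∈ stdSimplex ℝ (Fin K)) : ∃ ν : ℝ, ∑ a, max (p a - ν) πmin = 1 := by
  have hc : Continuous fun ν : ℝ => ∑ a, max (p a - ν) πmin := by fun_prop
  have h0 : (1 : ℝ) ≤ ∑ a, max (p a - 0) πmin := by
    calc (1 : ℝ) = ∑ a, p a := hp.2.symm
      _ ≤ _ := Finset.sum_le_sum fun a _ => by simp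
  have h1 : ∑ a, max (p a - (1 - πmin)) πmin ≤ 1 := by
    have : ∀ a, max (p a - (1 - πmin)) πmin = πmin := fun a => by
      have : p a ≤ 1 := hp.2 ▸ Finset.single_le_sum (fun b _ => hp.1 b) (Finset.mem_univ a)
      exact max_eq_right (by linarith)
    simpa [this] using hK
  obtain ⟨ν, hν⟩ := mem_range_of_exists_le_of_exists_ge hc ⟨_, h1⟩ ⟨_, h0⟩
  exact ⟨ν, hν⟩

/-- The clipped vector does not depend on the choice of the shift. -/
theorem clip_unique {K : ℕ} {πmin : ℝ} {p : Fin K → ℝ} {ν ν' : ℝ}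
    (h : ∑ a, max (p a - ν) πmin = 1) (h' : ∑ a, max (p a - ν') πmin = 1) (a : Fin K) :
    max (p a - ν) πmin = max (p a - ν') πmin := by
  wlog hle : ν ≤ ν' generalizing ν ν'
  · exact (this h' h (le_of_not_ge hle)).symm
  have hmono : ∀ b ∈ Finset.univ, max (p b - ν') πmin ≤ max (p b - ν) πmin :=
    fun b _ => max_le_max (by linarith) le_rfl
  exact ((Finset.sum_eq_sum_iff_of_le hmono).1 (h'.trans h.symm) a (Finset.mem_univ a)).symm

/-- The shift is unique when `K * πmin < 1`. -/
theorem shift_unique {K : ℕ} {πmin : ℝ} (hK : (K : ℝ) * πmin < 1) {p : Fin K → ℝ} {ν ν' : ℝ}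
    (h : ∑ a, max (p a - ν) πmin = 1) (h' : ∑ a, max (p a - ν') πmin = 1) : ν = ν' := by
  have hex : ∃ a, πmin < max (p a - ν) πmin := by
    by_contra! hcon
    have : ∑ a : Fin K, max (p a - ν) πmin ≤ ∑ _a : Fin K, πmin :=
      Finset.sum_le_sum fun a _ => hcon a
    simp at this
    linarith
  obtain ⟨a, ha⟩ := hex
  have hu := clip_unique h h' a
  have ha' := hu ▸ ha
  rw [lt_max_iff] at ha ha'
  simp only [lt_irrefl, or_false] at ha ha'
  rw [max_eq_left ha.le, max_eq_left ha'.le] at hu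
  linarith

/-- The clipped Boltzmann policy for the linear working model `β`. -/
def clippedBoltzmann {d K : ℕ} (πmin γ : ℝ) (β : Fin K → Context d) (x : Context d) :
    Fin K → ℝ :=
  clip πmin (boltzmann γ β x)

/-- The clipped Boltzmann behavior policy driven by the ridge estimator. -/
def ridgeBoltzmannPolicy (d K : ℕ) (lam πmin γ : ℝ) : BehaviorPolicy d K :=
  fun _ h x => clippedBoltzmann πmin γ (ridge lam h) x

/-! ### Adaptively collected data -/

section Data

variable {Ω : Type*} {d K : ℕ}

/-- The observed outcome `Y_t = Y_t(A_t)`, where `Ypot t ω a` is the potential outcome `Y_t(a)`. -/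
def outcome (Ypot : ℕ → Ω → Fin K → ℝ) (A : ℕ → Ω → Fin K) (t : ℕ) (ω : Ω) : ℝ :=
  Ypot t ω (A t ω)

/-- The observed data of the first `t` rounds (rounds are numbered from `0`). -/
def history (X : ℕ → Ω → Context d) (Ypot : ℕ → Ω → Fin K → ℝ) (A : ℕ → Ω → Fin K)
    (t : ℕ) (ω : Ω) : History d K t :=
  fun τ => (X τ ω, A τ ω, outcome Ypot A τ ω)

/-- `X`, `Ypot`, `A` are the contexts, potential outcomes and actions of a stochastic contextual
bandit whose actions are drawn from the behavior policy `π`. -/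
structure IsBanditData [MeasurableSpace Ω] (μ : Measure Ω) (π : BehaviorPolicy d K)
    (X : ℕ → Ω → Context d) (Ypot : ℕ → Ω → Fin K → ℝ) (A : ℕ → Ω → Fin K) : Prop where
  measurable_context : ∀ t, Measurable (X t)
  measurable_potential : ∀ t, Measurable (Ypot t)
  measurable_action : ∀ t, Measurable (A t)
  /-- `(X_t, (Y_t(a))_a)` are independent over `t`, -/
  indep : iIndepFun (fun t ω => (X t ω, Ypot t ω)) μ
  /-- identically distributed, -/
  ident : ∀ t, IdentDistrib (fun ω => (X t ω, Ypot t ω)) (fun ω => (X 0 ω, Ypot 0 ω)) μ μ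
  /-- and independent of the data observed earlier. -/
  indep_history : ∀ t, IndepFun (fun ω => (X t ω, Ypot t ω)) (history X Ypot A t) μ
  /-- Given the history and the context, the action is drawn from the behavior policy and is
  independent of the potential outcomes (unconfoundedness): further conditioning on the potential
  outcomes does not change its law. -/
  action_law : ∀ t a,
    μ[(A t ⁻¹' {a}).indicator (fun _ => (1 : ℝ)) |
        MeasurableSpace.comap (fun ω => (history X Ypot A t ω, X t ω, Ypot t ω)) inferInstance]
      =ᵐ[μ] fun ω => π t (history X Ypot A t ω) (X t ω) a

/-- The noise `η_t = Y_t - y(X_t, A_t)` relative to a mean reward function `y`. -/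
def noise (y : Context d → Fin K → ℝ) (X : ℕ → Ω → Context d) (Ypot : ℕ → Ω → Fin K → ℝ)
    (A : ℕ → Ω → Fin K) (t : ℕ) (ω : Ω) : ℝ :=
  outcome Ypot A t ω - y (X t ω) (A t ω)

/-- Regularity of the environment: bounded contexts, nondegenerate second moment matrix, bounded
mean reward function `y`, and noise of mean zero and bounded variance. The conditions on the noise
hold in particular if `η_t` is independent of `(H_{t-1}, X_t, A_t)`, with mean zero and
`𝔼 η_t² ≤ ση²`. -/
structure IsRegular [MeasurableSpace Ω] (μ : Measure Ω) (X : ℕ → Ω → Context d)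
    (Ypot : ℕ → Ω → Fin K → ℝ) (A : ℕ → Ω → Fin K) (y : Context d → Fin K → ℝ)
    (M σmin Ry ση : ℝ) : Prop where
  context_bound : ∀ t, ∀ᵐ ω ∂μ, ‖X t ω‖ ≤ M
  /-- `𝔼[X_t X_tᵀ] ⪰ σmin² I`. -/
  second_moment : ∀ t,
    (Matrix.of (fun i j : Fin d => ∫ ω, X t ω i * X t ω j ∂μ) -
      σmin ^ 2 • (1 : Matrix (Fin d) (Fin d) ℝ)).PosSemidef
  measurable_mean : ∀ a, Measurable fun x => y x a
  mean_bound : ∀ x a, ‖x‖ ≤ M → |y x a| ≤ Ry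
  noise_memLp : ∀ t, MemLp (noise y X Ypot A t) 2 μ
  /-- `𝔼[η_t | H_{t-1}, X_t, A_t] = 0`. -/
  noise_mean : ∀ t,
    μ[noise y X Ypot A t |
        MeasurableSpace.comap (fun ω => (history X Ypot A t ω, X t ω, A t ω)) inferInstance]
      =ᵐ[μ] 0
  noise_variance : ∀ t, ∫ ω, noise y X Ypot A t ω ^ 2 ∂μ ≤ ση ^ 2

/-- Policy convergence: there is one stationary policy `πbar` such that, for every action, the
difference of the selection probabilities under `π` and `πbar` tends to `0` in probability. -/
def PolicyConverges [MeasurableSpace Ω] (μ : Measure Ω) (π : BehaviorPolicy d K)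
    (X : ℕ → Ω → Context d) (Ypot : ℕ → Ω → Fin K → ℝ) (A : ℕ → Ω → Fin K) : Prop :=
  ∃ πbar : Context d → Fin K → ℝ, Measurable πbar ∧ (∀ x, πbar x ∈ stdSimplex ℝ (Fin K)) ∧
    ∀ a, TendstoInMeasure μ
      (fun t ω => π t (history X Ypot A t ω) (X t ω) a - πbar (X t ω) a) atTop (fun _ => (0 : ℝ))

end Data

end

end ContextualBandit

namespace ContextualBandit

/-! ### Regularity of the clipped Boltzmann policy -/

/-! For fixed selection weights, the population least-squares coefficients of an action are the zero
of `score`. Clipping keeps every weight at least `πmin`, so the score is strongly monotone with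
modulus `πmin * σmin ^ 2`. A high temperature makes the policy vary slowly with its parameters: on
`‖x‖ ≤ M` each probability is Lipschitz with constant `4 * M / γ`. Hence the map sending `β` to the
least-squares coefficients under the policy with parameters `β` is a contraction, with factor `1 /
4` as soon as `32 * M ^ 4 * Ry / (πmin * σmin ^ 2) ^ 2 ≤ γ`. Its fixed point (`exists_fixedPoint`)
is the limit.

For the convergence, the normal equations of action `a` are tested against the error `e` of the
estimator relative to `β a` (`ridge_error_equation`). Up to averages of martingale increments, the
quadratic side is at least `t * πmin * σmin ^ 2 * ‖e‖ ^ 2`, and the residual is the sum of the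
scores at `β a` under the policies used in the past rounds. The contraction estimate
`norm_score_le_quarter` bounds each of these scores by the error of its own round. So the current
error is at most half the average of the past errors, plus a remainder (`min_norm_ridge_sub_le`).

The remainder tends to zero in mean, because the increments are orthogonal and bounded in `L²`
(`tendstoZeroInMean_average_of_orthogonal`). Taking expectations leaves a recursion for real
numbers, and a bounded sequence satisfying it tends to zero (`tendsto_zero_of_le_half_average`).
Errors are truncated at `γ / (4 * M)` throughout: this makes them integrable, absorbs the event that
the empirical Gram matrix is nearly degenerate, and costs nothing, since two probabilities differ by
at most one. Convergence of the policy then follows from the Lipschitz bound. -/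

theorem boltzmann_mem_stdSimplex {d K : ℕ} [NeZero K] (γ : ℝ) (β : Fin K → Context d)
    (x : Context d) : boltzmann γ β x ∈ stdSimplex ℝ (Fin K) := by
  have hpos : 0 < ∑ b : Fin K, Real.exp (inner ℝ (β b) x / γ) :=
    Finset.sum_pos (fun b _ => Real.exp_pos _) Finset.univ_nonempty
  refine ⟨fun a => by unfold boltzmann; positivity, ?_⟩
  simp only [boltzmann]
  rw [← Finset.sum_div, div_self hpos.ne']

theorem sum_clip {K : ℕ} {πmin : ℝ} (hK : (K : ℝ) * πmin ≤ 1) {p : Fin K → ℝ}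
    (hp : p ∈ stdSimplex ℝ (Fin K)) : ∑ a, clip πmin p a = 1 :=
  Classical.epsilon_spec (exists_shift hK hp)

theorem le_clip {K : ℕ} (πmin : ℝ) (p : Fin K → ℝ) (a : Fin K) : πmin ≤ clip πmin p a :=
  le_max_right _ _

/-- One `ε` comes from the entries and one from the shift: changing the vector by `ε` is compensated
by moving the shift by at most `ε`. -/
theorem abs_clip_sub_clip_le {K : ℕ} {πmin : ℝ} (hK : (K : ℝ) * πmin ≤ 1) {p p' : Fin K → ℝ}
    (hp : p ∈ stdSimplex ℝ (Fin K)) (hp' : p' ∈ stdSimplex ℝ (Fin K)) {ε : ℝ}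
    (h : ∀ b, |p b - p' b| ≤ ε) (a : Fin K) :
    |clip πmin p a - clip πmin p' a| ≤ 2 * ε := by
  have hε : 0 ≤ ε := (abs_nonneg _).trans (h a)
  have h1 : ∑ b, max (p b - clipShift πmin p) πmin = 1 := sum_clip hK hp
  have h2 : ∑ b, max (p' b - clipShift πmin p') πmin = 1 := sum_clip hK hp'
  set ν := clipShift πmin p with hν
  have hc : Continuous fun ν : ℝ => ∑ b, max (p' b - ν) πmin := by fun_prop
  have hlow : ∑ b, max (p' b - (ν + ε)) πmin ≤ 1 := h1 ▸ Finset.sum_le_sum fun b _ =>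
    max_le_max (by have := abs_le.1 (h b); linarith) le_rfl
  have hhigh : 1 ≤ ∑ b, max (p' b - (ν - ε)) πmin := h1 ▸ Finset.sum_le_sum fun b _ =>
    max_le_max (by have := abs_le.1 (h b); linarith) le_rfl
  -- A shift for `p'` within `ε` of `ν`. It need not be `clipShift πmin p'`, as shifts are not
  -- unique when `K * πmin = 1`, but the clipped vector is the same.
  obtain ⟨ν', ⟨hν1, hν2⟩, hν'⟩ := intermediate_value_Icc' (by linarith : ν - ε ≤ ν + ε)
    hc.continuousOn ⟨hlow, hhigh⟩
  have h3 : clip πmin p' a = max (p' a - ν') πmin := clip_unique h2 hν' a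
  rw [h3]
  refine (abs_max_sub_max_le_abs _ _ _).trans ?_
  have := abs_le.1 (h a)
  rw [abs_le]
  constructor <;> linarith

/-- Numerator and denominator each change by a factor of at most `exp δ`, so the new probability is
at least `exp (-2δ)` times the old one. Since the old one is at most one, the drop is at most `1 -
exp (-2δ) ≤ 2δ`. -/
theorem boltzmann_sub_le {d K : ℕ} [NeZero K] {γ δ : ℝ} {β β' : Fin K → Context d}
    {x : Context d} (h : ∀ b, |inner ℝ (β b) x / γ - inner ℝ (β' b) x / γ| ≤ δ) (a : Fin K) :
    boltzmann γ β x a - boltzmann γ β' x a ≤ 2 * δ := by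
  have hp := boltzmann_mem_stdSimplex γ β x
  have hp0 := hp.1 a
  have hp1 : boltzmann γ β x a ≤ 1 := hp.2 ▸ Finset.single_le_sum (fun b _ => hp.1 b)
    (Finset.mem_univ a)
  have hδ : 0 ≤ δ := (abs_nonneg _).trans (h a)
  have hS : 0 < ∑ b : Fin K, Real.exp (inner ℝ (β b) x / γ) :=
    Finset.sum_pos (fun b _ => Real.exp_pos _) Finset.univ_nonempty
  have hS' : 0 < ∑ b : Fin K, Real.exp (inner ℝ (β' b) x / γ) :=
    Finset.sum_pos (fun b _ => Real.exp_pos _) Finset.univ_nonempty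
  have key : Real.exp (-(2 * δ)) * boltzmann γ β x a ≤ boltzmann γ β' x a := by
    have hden : ∑ b : Fin K, Real.exp (inner ℝ (β' b) x / γ) ≤
        Real.exp δ * ∑ b : Fin K, Real.exp (inner ℝ (β b) x / γ) := by
      rw [Finset.mul_sum]
      refine Finset.sum_le_sum fun b _ => ?_
      rw [← Real.exp_add]
      exact Real.exp_le_exp.2 (by have := abs_le.1 (h b); linarith)
    have hnum : Real.exp (-δ) * Real.exp (inner ℝ (β a) x / γ) ≤
        Real.exp (inner ℝ (β' a) x / γ) := by
      rw [← Real.exp_add]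
      exact Real.exp_le_exp.2 (by have := abs_le.1 (h a); linarith)
    unfold boltzmann
    rw [← mul_div_assoc, div_le_div_iff₀ hS hS']
    have e1 : Real.exp (-(2 * δ)) = Real.exp (-δ) * Real.exp (-δ) := by
      rw [← Real.exp_add]; congr 1; ring
    have e2 : Real.exp (-δ) * Real.exp δ = 1 := by rw [← Real.exp_add]; simp
    calc Real.exp (-(2 * δ)) * Real.exp (inner ℝ (β a) x / γ) *
          ∑ b : Fin K, Real.exp (inner ℝ (β' b) x / γ)
        ≤ Real.exp (-(2 * δ)) * Real.exp (inner ℝ (β a) x / γ) *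
          (Real.exp δ * ∑ b : Fin K, Real.exp (inner ℝ (β b) x / γ)) := by gcongr
      _ = (Real.exp (-δ) * Real.exp δ) * (Real.exp (-δ) * Real.exp (inner ℝ (β a) x / γ)) *
          ∑ b : Fin K, Real.exp (inner ℝ (β b) x / γ) := by rw [e1]; ring
      _ ≤ _ := by rw [e2, one_mul]; gcongr
  have := Real.add_one_le_exp (-(2 * δ))
  nlinarith

theorem abs_boltzmann_sub_le {d K : ℕ} [NeZero K] {γ δ : ℝ} {β β' : Fin K → Context d}
    {x : Context d} (h : ∀ b, |inner ℝ (β b) x / γ - inner ℝ (β' b) x / γ| ≤ δ) (a : Fin K) :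
    |boltzmann γ β x a - boltzmann γ β' x a| ≤ 2 * δ :=
  abs_sub_le_iff.2 ⟨boltzmann_sub_le h a,
    boltzmann_sub_le (fun b => by rw [abs_sub_comm]; exact h b) a⟩

section ClippedBoltzmann

variable {d K : ℕ} [NeZero K] {πmin γ : ℝ}

theorem clippedBoltzmann_mem_stdSimplex (hπ : 0 ≤ πmin) (hK : (K : ℝ) * πmin ≤ 1)
    (β : Fin K → Context d) (x : Context d) :
    clippedBoltzmann πmin γ β x ∈ stdSimplex ℝ (Fin K) :=
  ⟨fun _ => hπ.trans (le_clip _ _ _), sum_clip hK (boltzmann_mem_stdSimplex γ β x)⟩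

theorem clippedBoltzmann_le_one (hπ : 0 ≤ πmin) (hK : (K : ℝ) * πmin ≤ 1)
    (β : Fin K → Context d) (x : Context d) (a : Fin K) :
    clippedBoltzmann πmin γ β x a ≤ 1 := by
  have hp := clippedBoltzmann_mem_stdSimplex (γ := γ) hπ hK β x
  exact hp.2 ▸ Finset.single_le_sum (fun b _ => hp.1 b) (Finset.mem_univ a)

theorem abs_clippedBoltzmann_sub_le (hγ : 0 < γ) (hK : (K : ℝ) * πmin ≤ 1)
    (β β' : Fin K → Context d) (x : Context d) (a : Fin K) :
    |clippedBoltzmann πmin γ β x a - clippedBoltzmann πmin γ β' x a| ≤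
      4 * ‖x‖ / γ * ‖β - β'‖ := by
  have h : ∀ b, |inner ℝ (β b) x / γ - inner ℝ (β' b) x / γ| ≤ ‖x‖ / γ * ‖β - β'‖ := by
    intro b
    rw [← sub_div, ← inner_sub_left, abs_div, abs_of_pos hγ, div_mul_eq_mul_div]
    have h1 := abs_real_inner_le_norm (β b - β' b) x
    have h2 : ‖β b - β' b‖ ≤ ‖β - β'‖ := norm_le_pi_norm (β - β') b
    gcongr
    nlinarith [norm_nonneg x]
  refine (abs_clip_sub_clip_le hK (boltzmann_mem_stdSimplex γ β x)
    (boltzmann_mem_stdSimplex γ β' x) (abs_boltzmann_sub_le h) a).trans (le_of_eq ?_)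
  ring

/-- The shift is obtained by choice, so continuity is drawn from the Lipschitz estimate for
clipping; `ε / 3` makes the doubled error strictly less than `ε`. -/
theorem continuous_clippedBoltzmann (hK : (K : ℝ) * πmin ≤ 1) (a : Fin K) :
    Continuous fun z : (Fin K → Context d) × Context d => clippedBoltzmann πmin γ z.1 z.2 a := by
  have hb : Continuous fun z : (Fin K → Context d) × Context d => boltzmann γ z.1 z.2 := by
    refine continuous_pi fun b => ?_
    unfold boltzmann
    refine Continuous.div (by fun_prop) (by fun_prop) fun z => ?_
    exact (Finset.sum_pos (fun b _ => Real.exp_pos _) Finset.univ_nonempty).ne'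
  rw [Metric.continuous_iff] at hb ⊢
  intro z ε hε
  obtain ⟨δ, hδ, h⟩ := hb z (ε / 3) (by positivity)
  refine ⟨δ, hδ, fun w hw => ?_⟩
  have h1 := abs_clip_sub_clip_le hK (boltzmann_mem_stdSimplex γ w.1 w.2)
    (boltzmann_mem_stdSimplex γ z.1 z.2) (ε := ε / 3) (fun b => by
      have := (dist_le_pi_dist (boltzmann γ w.1 w.2) (boltzmann γ z.1 z.2) b).trans (h w hw).le
      rwa [Real.dist_eq] at this) a
  rw [Real.dist_eq]
  unfold clippedBoltzmann
  linarith

end ClippedBoltzmann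

/-! ### The population normal equations and the fixed point -/

section Population

noncomputable section

variable {d : ℕ} {P : Measure (Context d)} [IsProbabilityMeasure P] {M s Ry p : ℝ}
  {w w' f : Context d → ℝ}

/-- The score `𝔼[w(X) (f(X) - ⟨θ, X⟩) X]` of weighted least squares. -/
def score (P : Measure (Context d)) (w f : Context d → ℝ) (θ : Context d) : Context d :=
  ∫ x, (w x * (f x - inner ℝ θ x)) • x ∂P

theorem integrable_smul_context (hM : ∀ᵐ x ∂P, ‖x‖ ≤ M) {g : Context d → ℝ} (hg : Measurable g)
    {C : ℝ} (hC : ∀ x, ‖x‖ ≤ M → |g x| ≤ C) : Integrable (fun x => g x • x) P := by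
  refine Integrable.of_bound (hg.smul measurable_id).aestronglyMeasurable (C * M) ?_
  filter_upwards [hM] with x hx
  rw [norm_smul, Real.norm_eq_abs]
  have := hC x hx
  have := abs_nonneg (g x)
  have := norm_nonneg x
  gcongr
  linarith

theorem norm_integral_smul_context_le (hM : ∀ᵐ x ∂P, ‖x‖ ≤ M) {g : Context d → ℝ}
    {C : ℝ} (hC0 : 0 ≤ C) (hC : ∀ x, ‖x‖ ≤ M → |g x| ≤ C) : ‖∫ x, g x • x ∂P‖ ≤ C * M := by
  have h : ∀ᵐ x ∂P, ‖g x • x‖ ≤ C * M := by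
    filter_upwards [hM] with x hx
    rw [norm_smul, Real.norm_eq_abs]
    have := hC x hx
    gcongr
  simpa using norm_integral_le_of_norm_le_const h

theorem abs_sub_inner_le {θ x : Context d} (hf : ∀ x, ‖x‖ ≤ M → |f x| ≤ Ry) (hx : ‖x‖ ≤ M) :
    |f x - inner ℝ θ x| ≤ Ry + ‖θ‖ * M := by
  have h1 := hf x hx
  have h2 := abs_real_inner_le_norm θ x
  have h3 : ‖θ‖ * ‖x‖ ≤ ‖θ‖ * M := by gcongr
  exact (abs_sub _ _).trans (by linarith)

theorem abs_weight_mul_le {θ : Context d} (hw0 : ∀ x, 0 ≤ w x)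
    (hw1 : ∀ x, w x ≤ 1) (hf : ∀ x, ‖x‖ ≤ M → |f x| ≤ Ry) (x : Context d) (hx : ‖x‖ ≤ M) :
    |w x * (f x - inner ℝ θ x)| ≤ Ry + ‖θ‖ * M := by
  rw [abs_mul, abs_of_nonneg (hw0 x)]
  exact (mul_le_of_le_one_left (abs_nonneg _) (hw1 x)).trans (abs_sub_inner_le hf hx)

theorem integrable_score (hM : ∀ᵐ x ∂P, ‖x‖ ≤ M) (hw : Measurable w) (hw0 : ∀ x, 0 ≤ w x)
    (hw1 : ∀ x, w x ≤ 1) (hfm : Measurable f) (hf : ∀ x, ‖x‖ ≤ M → |f x| ≤ Ry) (θ : Context d) :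
    Integrable (fun x => (w x * (f x - inner ℝ θ x)) • x) P :=
  integrable_smul_context hM (by fun_prop) (abs_weight_mul_le hw0 hw1 hf)

theorem sq_norm_le_integral_weight (hM : ∀ᵐ x ∂P, ‖x‖ ≤ M)
    (hs : ∀ v, s * ‖v‖ ^ 2 ≤ ∫ x, inner ℝ v x ^ 2 ∂P) (hp : 0 ≤ p) (hw : Measurable w)
    (hwp : ∀ x, p ≤ w x) (hw1 : ∀ x, w x ≤ 1) (v : Context d) :
    p * s * ‖v‖ ^ 2 ≤ ∫ x, w x * inner ℝ v x ^ 2 ∂P := by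
  have hb : ∀ᵐ x ∂P, inner ℝ v x ^ 2 ≤ (‖v‖ * M) ^ 2 := by
    filter_upwards [hM] with x hx
    rw [← sq_abs]
    have := abs_real_inner_le_norm v x
    gcongr
    exact this.trans (by gcongr)
  have h1 : Integrable (fun x => inner ℝ v x ^ 2) P := by
    refine Integrable.of_bound (by fun_prop) ((‖v‖ * M) ^ 2) ?_
    filter_upwards [hb] with x hx
    rwa [Real.norm_of_nonneg (sq_nonneg _)]
  have h2 : Integrable (fun x => w x * inner ℝ v x ^ 2) P := by
    refine h1.mono (by fun_prop) (.of_forall fun x => ?_)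
    rw [norm_mul, Real.norm_of_nonneg (hp.trans (hwp x))]
    exact mul_le_of_le_one_left (norm_nonneg _) (hw1 x)
  calc p * s * ‖v‖ ^ 2 = p * (s * ‖v‖ ^ 2) := by ring
    _ ≤ p * ∫ x, inner ℝ v x ^ 2 ∂P := by gcongr; exact hs v
    _ = ∫ x, p * inner ℝ v x ^ 2 ∂P := (integral_const_mul _ _).symm
    _ ≤ _ := integral_mono (h1.const_mul p) h2 fun x => by
        have := hwp x
        dsimp only
        gcongr

theorem score_sub_score (hM : ∀ᵐ x ∂P, ‖x‖ ≤ M) (hw : Measurable w) (hw0 : ∀ x, 0 ≤ w x)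
    (hw1 : ∀ x, w x ≤ 1) (hfm : Measurable f) (hf : ∀ x, ‖x‖ ≤ M → |f x| ≤ Ry)
    (θ θ' : Context d) :
    score P w f θ - score P w f θ' = ∫ x, (w x * inner ℝ (θ' - θ) x) • x ∂P := by
  unfold score
  rw [← integral_sub (integrable_score hM hw hw0 hw1 hfm hf θ)
    (integrable_score hM hw hw0 hw1 hfm hf θ')]
  congr 1 with x : 1
  rw [← sub_smul, inner_sub_left]
  congr 1
  ring

theorem integrable_weight_inner (hM : ∀ᵐ x ∂P, ‖x‖ ≤ M) (hw : Measurable w)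
    (hw0 : ∀ x, 0 ≤ w x) (hw1 : ∀ x, w x ≤ 1) (v : Context d) :
    Integrable (fun x => (w x * inner ℝ v x) • x) P := by
  simpa using integrable_score (f := fun _ => 0) (Ry := 0) hM hw hw0 hw1 measurable_const
    (by simp) (-v)

theorem inner_integral_weight (hM : ∀ᵐ x ∂P, ‖x‖ ≤ M) (hw : Measurable w)
    (hw0 : ∀ x, 0 ≤ w x) (hw1 : ∀ x, w x ≤ 1) (v : Context d) :
    inner ℝ v (∫ x, (w x * inner ℝ v x) • x ∂P) = ∫ x, w x * inner ℝ v x ^ 2 ∂P := by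
  rw [← integral_inner (integrable_weight_inner hM hw hw0 hw1 v)]
  congr 1 with x : 1
  rw [inner_smul_right]
  ring

/-- Coercivity of the weighted second moment operator, by pairing with `v` and Cauchy–Schwarz. -/
theorem norm_le_norm_integral_weight (hM : ∀ᵐ x ∂P, ‖x‖ ≤ M)
    (hs : ∀ v, s * ‖v‖ ^ 2 ≤ ∫ x, inner ℝ v x ^ 2 ∂P) (hp : 0 ≤ p) (hw : Measurable w)
    (hwp : ∀ x, p ≤ w x) (hw1 : ∀ x, w x ≤ 1) (v : Context d) :
    p * s * ‖v‖ ≤ ‖∫ x, (w x * inner ℝ v x) • x ∂P‖ := by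
  have hw0 : ∀ x, 0 ≤ w x := fun x => hp.trans (hwp x)
  have h1 := sq_norm_le_integral_weight hM hs hp hw hwp hw1 v
  rw [← inner_integral_weight hM hw hw0 hw1 v] at h1
  have h2 := real_inner_le_norm v (∫ x, (w x * inner ℝ v x) • x ∂P)
  rcases (norm_nonneg v).eq_or_lt with h0 | h0
  · rw [← h0, mul_zero]
    exact norm_nonneg _
  · refine le_of_mul_le_mul_left ?_ h0
    nlinarith

theorem norm_sub_le_score_sub (hM : ∀ᵐ x ∂P, ‖x‖ ≤ M)
    (hs : ∀ v, s * ‖v‖ ^ 2 ≤ ∫ x, inner ℝ v x ^ 2 ∂P) (hp : 0 ≤ p) (hw : Measurable w)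
    (hwp : ∀ x, p ≤ w x) (hw1 : ∀ x, w x ≤ 1) (hfm : Measurable f)
    (hf : ∀ x, ‖x‖ ≤ M → |f x| ≤ Ry) (θ θ' : Context d) :
    p * s * ‖θ - θ'‖ ≤ ‖score P w f θ - score P w f θ'‖ := by
  rw [score_sub_score hM hw (fun x => hp.trans (hwp x)) hw1 hfm hf, norm_sub_rev θ θ']
  exact norm_le_norm_integral_weight hM hs hp hw hwp hw1 _

/-- The score is affine in `θ`. Its linear part is injective by coercivity, hence surjective in
finite dimension. -/
theorem exists_score_eq_zero (hM : ∀ᵐ x ∂P, ‖x‖ ≤ M)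
    (hs : ∀ v, s * ‖v‖ ^ 2 ≤ ∫ x, inner ℝ v x ^ 2 ∂P) (hps : 0 < p * s) (hp : 0 ≤ p)
    (hw : Measurable w) (hwp : ∀ x, p ≤ w x) (hw1 : ∀ x, w x ≤ 1) (hfm : Measurable f)
    (hf : ∀ x, ‖x‖ ≤ M → |f x| ≤ Ry) : ∃ θ, score P w f θ = 0 := by
  have hw0 : ∀ x, 0 ≤ w x := fun x => hp.trans (hwp x)
  let T : Context d →ₗ[ℝ] Context d :=
    { toFun := fun v => ∫ x, (w x * inner ℝ v x) • x ∂P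
      map_add' := fun u v => by
        rw [← integral_add (integrable_weight_inner hM hw hw0 hw1 u)
          (integrable_weight_inner hM hw hw0 hw1 v)]
        congr 1 with x : 1
        rw [← add_smul, inner_add_left, mul_add]
      map_smul' := fun c v => by
        simp only [RingHom.id_apply]
        rw [← integral_smul]
        congr 1 with x : 1
        rw [smul_smul, real_inner_smul_left]
        congr 1
        ring }
  have hT : ∀ v, T v = ∫ x, (w x * inner ℝ v x) • x ∂P := fun v => rfl
  have hinj : Function.Injective T := by
    rw [← LinearMap.ker_eq_bot, LinearMap.ker_eq_bot']
    intro v hv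
    have h1 := norm_le_norm_integral_weight hM hs hp hw hwp hw1 v
    rw [← hT, hv, norm_zero] at h1
    have h2 : ‖v‖ ≤ 0 := by
      by_contra! h3
      have := mul_pos hps h3
      linarith
    exact norm_le_zero_iff.1 h2
  obtain ⟨θ, hθ⟩ := LinearMap.injective_iff_surjective.1 hinj (score P w f 0)
  refine ⟨θ, ?_⟩
  have h := score_sub_score hM hw hw0 hw1 hfm hf 0 θ
  rw [sub_zero, ← hT, hθ] at h
  simpa using h

/-- Strong monotonicity is applied between `θ` and `0`, where the score has norm at most `Ry * M`.
-/
theorem norm_le_of_score_eq_zero (hM : ∀ᵐ x ∂P, ‖x‖ ≤ M)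
    (hs : ∀ v, s * ‖v‖ ^ 2 ≤ ∫ x, inner ℝ v x ^ 2 ∂P) (hps : 0 < p * s) (hp : 0 ≤ p)
    (hRy : 0 ≤ Ry)
    (hw : Measurable w) (hwp : ∀ x, p ≤ w x) (hw1 : ∀ x, w x ≤ 1) (hfm : Measurable f)
    (hf : ∀ x, ‖x‖ ≤ M → |f x| ≤ Ry) {θ : Context d} (hθ : score P w f θ = 0) :
    ‖θ‖ ≤ M * Ry / (p * s) := by
  have h1 := norm_sub_le_score_sub hM hs hp hw hwp hw1 hfm hf θ 0
  have h2 : ‖score P w f 0‖ ≤ Ry * M := by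
    refine norm_integral_smul_context_le hM hRy fun x hx => ?_
    simpa using abs_weight_mul_le (θ := 0) (fun x => hp.trans (hwp x)) hw1 hf x hx
  rw [hθ, sub_zero, zero_sub, norm_neg] at h1
  rw [le_div_iff₀ hps]
  linarith

/-- Subtracting the vanishing score for `w'` leaves only the difference of the weights under the
integral. -/
theorem norm_score_le_of_score_eq_zero (hM : ∀ᵐ x ∂P, ‖x‖ ≤ M) (hw : Measurable w)
    (hw0 : ∀ x, 0 ≤ w x)
    (hw1 : ∀ x, w x ≤ 1) (hw' : Measurable w') (hw'0 : ∀ x, 0 ≤ w' x) (hw'1 : ∀ x, w' x ≤ 1)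
    (hfm : Measurable f) (hf : ∀ x, ‖x‖ ≤ M → |f x| ≤ Ry) (hRy : 0 ≤ Ry) (hM0 : 0 ≤ M)
    {θ : Context d} (hθ : score P w' f θ = 0) {δ : ℝ} (hδ0 : 0 ≤ δ)
    (hδ : ∀ x, ‖x‖ ≤ M → |w x - w' x| ≤ δ) :
    ‖score P w f θ‖ ≤ δ * (Ry + ‖θ‖ * M) * M := by
  rw [← sub_zero (score P w f θ), ← hθ]
  unfold score
  rw [← integral_sub (integrable_score hM hw hw0 hw1 hfm hf θ)
    (integrable_score hM hw' hw'0 hw'1 hfm hf θ)]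
  simp_rw [← sub_smul, ← sub_mul]
  refine norm_integral_smul_context_le hM (by positivity) fun x hx => ?_
  rw [abs_mul]
  have := hδ x hx
  have := abs_sub_inner_le (θ := θ) hf hx
  gcongr

end

/-! ### Contraction of the population least-squares map -/

section FixedPoint

variable {d K : ℕ} [NeZero K] {P : Measure (Context d)} [IsProbabilityMeasure P]
  {M s Ry πmin γ : ℝ} {y : Context d → Fin K → ℝ}

theorem measurable_clippedBoltzmann (hK : (K : ℝ) * πmin ≤ 1) (β : Fin K → Context d)
    (a : Fin K) : Measurable fun x => clippedBoltzmann πmin γ β x a :=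
  ((continuous_clippedBoltzmann (γ := γ) hK a).comp
    (Continuous.prodMk_right β)).measurable

/-- Tested on a unit coordinate vector, which requires positive dimension. -/
theorem le_sq_of_second_moment (hd : 0 < d) (hM : ∀ᵐ x ∂P, ‖x‖ ≤ M)
    (hs : ∀ v, s * ‖v‖ ^ 2 ≤ ∫ x, inner ℝ v x ^ 2 ∂P) : s ≤ M ^ 2 := by
  have h := hs (EuclideanSpace.single ⟨0, hd⟩ 1)
  rw [PiLp.norm_single] at h
  simp only [norm_one, one_pow, mul_one] at h
  refine h.trans ?_
  have hb : ∀ᵐ x ∂P, ‖inner ℝ (EuclideanSpace.single (⟨0, hd⟩ : Fin d) (1 : ℝ)) x ^ 2‖ ≤ M ^ 2 := by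
    filter_upwards [hM] with x hx
    rw [norm_pow]
    have := norm_inner_le_norm (𝕜 := ℝ) (EuclideanSpace.single (⟨0, hd⟩ : Fin d) (1 : ℝ)) x
    rw [PiLp.norm_single, norm_one, one_mul] at this
    gcongr
    linarith
  exact (le_abs_self _).trans (by simpa using norm_integral_le_of_norm_le_const hb)

/-- The score at a root of another policy's score is controlled by the distance of the policies'
parameters: this is the contraction estimate. -/
theorem norm_score_le_quarter (hM : ∀ᵐ x ∂P, ‖x‖ ≤ M) (hM0 : 0 < M)
    (hs : ∀ v, s * ‖v‖ ^ 2 ≤ ∫ x, inner ℝ v x ^ 2 ∂P) (hs0 : 0 < s) (hRy : 0 < Ry)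
    (hπ : 0 < πmin) (hK : (K : ℝ) * πmin ≤ 1) (hγ : 32 * M ^ 4 * Ry / (πmin * s) ^ 2 ≤ γ)
    (hym : ∀ a, Measurable fun x => y x a) (hy : ∀ x a, ‖x‖ ≤ M → |y x a| ≤ Ry)
    (β β' : Fin K → Context d) (a : Fin K) {θ : Context d}
    (hθ : score P (fun x => clippedBoltzmann πmin γ β' x a) (fun x => y x a) θ = 0) :
    ‖score P (fun x => clippedBoltzmann πmin γ β x a) (fun x => y x a) θ‖ ≤
      πmin * s / 4 * min ‖β - β'‖ (γ / (4 * M)) := by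
  -- In dimension zero the second moment condition is vacuous and `s ≤ M ^ 2` may fail, but every
  -- score vanishes.
  rcases Nat.eq_zero_or_pos d with rfl | hd
  · rw [Subsingleton.elim (score P (fun x => clippedBoltzmann πmin γ β x a)
      (fun x => y x a) θ) 0, norm_zero]
    have : 0 < γ := lt_of_lt_of_le (by positivity) hγ
    positivity
  have hγ0 : 0 < γ := lt_of_lt_of_le (by positivity) hγ
  set m := min ‖β - β'‖ (γ / (4 * M)) with hm
  have hm0 : 0 ≤ m := by positivity
  have hδ : ∀ x : Context d, ‖x‖ ≤ M →
      |clippedBoltzmann πmin γ β x a - clippedBoltzmann πmin γ β' x a| ≤ 4 * M / γ * m := by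
    intro x hx
    rw [hm, mul_min_of_nonneg _ _ (by positivity)]
    refine le_min ?_ ?_
    · refine (abs_clippedBoltzmann_sub_le hγ0 hK β β' x a).trans ?_
      gcongr
    -- The truncation level `γ / (4 * M)` is where the Lipschitz bound reaches the trivial bound
    -- `1`.
    · have e : 4 * M / γ * (γ / (4 * M)) = 1 := by field_simp
      rw [e, abs_le]
      have h1 := clippedBoltzmann_le_one (γ := γ) hπ.le hK β x a
      have h2 := clippedBoltzmann_le_one (γ := γ) hπ.le hK β' x a
      have h3 := le_clip πmin (boltzmann γ β x) a
      have h4 := le_clip πmin (boltzmann γ β' x) a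
      simp only [clippedBoltzmann] at *
      constructor <;> linarith
  have hw := measurable_clippedBoltzmann (γ := γ) hK (d := d) (πmin := πmin)
  have hw0 : ∀ β x, 0 ≤ clippedBoltzmann (d := d) πmin γ β x a := fun β x =>
    hπ.le.trans (le_clip _ _ _)
  have hw1 : ∀ β x, clippedBoltzmann (d := d) πmin γ β x a ≤ 1 := fun β x =>
    clippedBoltzmann_le_one hπ.le hK β x a
  have h := norm_score_le_of_score_eq_zero hM (hw β a) (hw0 β) (hw1 β) (hw β' a) (hw0 β') (hw1 β')
    (hym a) (fun x => hy x a) hRy.le hM0.le hθ (by positivity) hδ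
  have hnorm := norm_le_of_score_eq_zero hM hs (p := πmin) (by positivity) hπ.le hRy.le (hw β' a)
    (fun x => le_clip _ _ _) (hw1 β') (hym a) (fun x => hy x a) hθ
  have hsM : s ≤ M ^ 2 := le_sq_of_second_moment hd hM hs
  have hπ1 : πmin ≤ 1 := by
    have : (1 : ℝ) ≤ K := by exact_mod_cast NeZero.one_le
    nlinarith
  have hpsM : πmin * s ≤ M ^ 2 := by nlinarith
  refine h.trans ?_
  -- Because `πmin * s ≤ M ^ 2`, the term `Ry` is dominated by the bound for `‖θ‖ * M`.
  have h1 : (Ry + ‖θ‖ * M) * M ≤ 2 * M ^ 3 * Ry / (πmin * s) := by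
    have e : ‖θ‖ * M ≤ M * Ry / (πmin * s) * M := by gcongr
    have e2 : Ry ≤ M * Ry / (πmin * s) * M := by
      rw [div_mul_eq_mul_div, le_div_iff₀ (by positivity)]
      nlinarith
    calc (Ry + ‖θ‖ * M) * M ≤ (M * Ry / (πmin * s) * M + M * Ry / (πmin * s) * M) * M := by
          gcongr
      _ = _ := by ring
  -- This is exactly the lower bound on `γ`, whose constant is `32 = 4 * 2 * 4`.
  have h2 : 4 * M / γ * (2 * M ^ 3 * Ry / (πmin * s)) ≤ πmin * s / 4 := by
    rw [div_le_iff₀ (by positivity)] at hγ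
    rw [div_mul_div_comm, div_le_div_iff₀ (by positivity) (by positivity)]
    nlinarith
  calc 4 * M / γ * m * (Ry + ‖θ‖ * M) * M
      = m * (4 * M / γ * ((Ry + ‖θ‖ * M) * M)) := by ring
    _ ≤ m * (4 * M / γ * (2 * M ^ 3 * Ry / (πmin * s))) := by gcongr
    _ ≤ m * (πmin * s / 4) := by gcongr
    _ = _ := by ring

/-- Banach's fixed point theorem. The sup metric over actions lets the estimate be made one action
at a time. -/
theorem exists_fixedPoint (hM : ∀ᵐ x ∂P, ‖x‖ ≤ M) (hM0 : 0 < M)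
    (hs : ∀ v, s * ‖v‖ ^ 2 ≤ ∫ x, inner ℝ v x ^ 2 ∂P) (hs0 : 0 < s) (hRy : 0 < Ry)
    (hπ : 0 < πmin) (hK : (K : ℝ) * πmin ≤ 1) (hγ : 32 * M ^ 4 * Ry / (πmin * s) ^ 2 ≤ γ)
    (hym : ∀ a, Measurable fun x => y x a) (hy : ∀ x a, ‖x‖ ≤ M → |y x a| ≤ Ry) :
    ∃ β : Fin K → Context d, ∀ a,
      score P (fun x => clippedBoltzmann πmin γ β x a) (fun x => y x a) (β a) = 0 := by
  have hw := measurable_clippedBoltzmann (γ := γ) hK (d := d) (πmin := πmin)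
  have hw1 : ∀ β a x, clippedBoltzmann (d := d) πmin γ β x a ≤ 1 := fun β a x =>
    clippedBoltzmann_le_one hπ.le hK β x a
  choose F hF using fun (β : Fin K → Context d) (a : Fin K) =>
    exists_score_eq_zero hM hs (p := πmin) (by positivity) hπ.le (hw β a)
      (fun x => le_clip _ _ _) (hw1 β a) (hym a) (fun x => hy x a)
  have hlip : LipschitzWith (1 / 4) F := by
    refine LipschitzWith.of_dist_le_mul fun β β' => ?_
    refine (dist_pi_le_iff (by positivity)).2 fun a => ?_
    have h1 := norm_sub_le_score_sub hM hs hπ.le (hw β a)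
      (fun x => le_clip _ _ _) (hw1 β a) (hym a) (fun x => hy x a) (F β a) (F β' a)
    rw [hF, zero_sub, norm_neg] at h1
    have h2 := h1.trans (norm_score_le_quarter hM hM0 hs hs0 hRy hπ hK hγ hym hy β β' a (hF β' a))
    have h3 : min ‖β - β'‖ (γ / (4 * M)) ≤ ‖β - β'‖ := min_le_left _ _
    have hps : 0 < πmin * s := by positivity
    rw [dist_eq_norm, dist_eq_norm]
    refine le_of_mul_le_mul_left (h2.trans ?_) hps
    have : ((1 / 4 : NNReal) : ℝ) = 1 / 4 := by simp
    rw [this]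
    nlinarith
  have hc : ContractingWith (1 / 4) F := ⟨by
    rw [div_lt_one (by norm_num)]; norm_num, hlip⟩
  refine ⟨hc.fixedPoint F, fun a => ?_⟩
  have h := hF (hc.fixedPoint F) a
  rwa [hc.fixedPoint_isFixedPt.eq] at h

end FixedPoint

end Population

/-! ### Laws of large numbers in mean -/

/-- Convergence to zero in mean. -/
def TendstoZeroInMean {Ω : Type*} [MeasurableSpace Ω] (μ : Measure Ω) (ζ : ℕ → Ω → ℝ) : Prop :=
  (∀ t, Integrable (ζ t) μ) ∧ Tendsto (fun t => ∫ ω, |ζ t ω| ∂μ) atTop (nhds 0)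

namespace TendstoZeroInMean

variable {Ω : Type*} [MeasurableSpace Ω] {μ : Measure Ω} {ζ ζ' : ℕ → Ω → ℝ}

theorem add (h : TendstoZeroInMean μ ζ) (h' : TendstoZeroInMean μ ζ') :
    TendstoZeroInMean μ fun t ω => ζ t ω + ζ' t ω := by
  refine ⟨fun t => (h.1 t).add (h'.1 t), squeeze_zero (fun t => integral_nonneg fun ω =>
    abs_nonneg _) (fun t => ?_) (by simpa using h.2.add h'.2)⟩
  rw [← integral_add (h.1 t).abs (h'.1 t).abs]
  exact integral_mono ((h.1 t).add (h'.1 t)).abs ((h.1 t).abs.add (h'.1 t).abs)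
    fun ω => abs_add_le _ _

theorem const_mul (h : TendstoZeroInMean μ ζ) (c : ℝ) :
    TendstoZeroInMean μ fun t ω => c * ζ t ω := by
  refine ⟨fun t => (h.1 t).const_mul c, ?_⟩
  simp_rw [abs_mul, integral_const_mul]
  simpa using h.2.const_mul |c|

theorem abs (h : TendstoZeroInMean μ ζ) : TendstoZeroInMean μ fun t ω => |ζ t ω| :=
  ⟨fun t => (h.1 t).abs, by simpa using h.2⟩

theorem const [IsProbabilityMeasure μ] {δ : ℕ → ℝ} (h : Tendsto δ atTop (nhds 0)) :
    TendstoZeroInMean μ fun t _ => δ t :=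
  ⟨fun _ => integrable_const _, by simpa using h.abs⟩

theorem sum {ι : Type*} [IsProbabilityMeasure μ] {ξ : ι → ℕ → Ω → ℝ} (S : Finset ι)
    (h : ∀ i, TendstoZeroInMean μ (ξ i)) :
    TendstoZeroInMean μ fun t ω => ∑ i ∈ S, ξ i t ω := by
  classical
  induction S using Finset.induction_on with
  | empty => simpa using const (μ := μ) tendsto_const_nhds
  | insert i S hi ih => simpa [Finset.sum_insert hi] using (h i).add ih

theorem tendsto_integral (h : TendstoZeroInMean μ ζ) :
    Tendsto (fun t => ∫ ω, ζ t ω ∂μ) atTop (nhds 0) :=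
  squeeze_zero_norm (fun _ => norm_integral_le_integral_norm _) h.2

end TendstoZeroInMean

/-- By orthogonality the second moment of the sum grows at most linearly, so the mean of the
absolute average is of order `1 / √t`. -/
theorem tendstoZeroInMean_average_of_orthogonal {Ω : Type*} [MeasurableSpace Ω] {μ : Measure Ω}
    [IsProbabilityMeasure μ] {ξ : ℕ → Ω → ℝ} (hξ : ∀ t, MemLp (ξ t) 2 μ) {C : ℝ}
    (hC : ∀ t, ∫ ω, ξ t ω ^ 2 ∂μ ≤ C)
    (horth : ∀ s t, s < t → ∫ ω, ξ s ω * ξ t ω ∂μ = 0) :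
    TendstoZeroInMean μ fun t ω => (∑ s ∈ Finset.range t, ξ s ω) / t := by
  have hS : ∀ t, MemLp (fun ω => ∑ s ∈ Finset.range t, ξ s ω) 2 μ := fun t =>
    memLp_finsetSum _ fun s _ => hξ s
  have hsq : ∀ t : ℕ, ∫ ω, (∑ s ∈ Finset.range t, ξ s ω) ^ 2 ∂μ ≤ t * C := by
    intro t
    induction t with
    | zero => simp
    | succ t ih =>
      have h0 : ∫ ω, (∑ s ∈ Finset.range t, ξ s ω) * ξ t ω ∂μ = 0 := by
        simp_rw [Finset.sum_mul]
        have hint : ∀ s ∈ Finset.range t, Integrable (fun ω => ξ s ω * ξ t ω) μ :=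
          fun s _ => (hξ s).integrable_mul (hξ t)
        rw [integral_finsetSum _ hint]
        exact Finset.sum_eq_zero fun s hs => horth s t (Finset.mem_range.1 hs)
      have h1 : Integrable (fun ω => (∑ s ∈ Finset.range t, ξ s ω) * ξ t ω) μ :=
        (hS t).integrable_mul (hξ t)
      have h2 := (hS t).integrable_sq
      have h3 := (hξ t).integrable_sq
      have e : ∀ ω, (∑ s ∈ Finset.range (t + 1), ξ s ω) ^ 2 =
          ((∑ s ∈ Finset.range t, ξ s ω) ^ 2 +
            2 * ((∑ s ∈ Finset.range t, ξ s ω) * ξ t ω)) + ξ t ω ^ 2 := fun ω => by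
        rw [Finset.sum_range_succ]
        ring
      have h4 : Integrable (fun ω => (∑ s ∈ Finset.range t, ξ s ω) ^ 2 +
          2 * ((∑ s ∈ Finset.range t, ξ s ω) * ξ t ω)) μ := h2.add (h1.const_mul 2)
      simp_rw [e]
      rw [integral_add h4 h3, integral_add h2 (h1.const_mul 2),
        integral_const_mul, h0]
      have := hC t
      push_cast
      linarith
  refine ⟨fun t => ((hS t).integrable one_le_two).div_const _, ?_⟩
  have hlim : Tendsto (fun t : ℕ => (1 + C) / 2 * (Real.sqrt t)⁻¹) atTop (nhds 0) := by
    have := (tendsto_inv_atTop_zero.comp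
      (Real.tendsto_sqrt_atTop.comp tendsto_natCast_atTop_atTop)).const_mul ((1 + C) / 2)
    simpa using this
  refine squeeze_zero' (.of_forall fun t => integral_nonneg fun ω => abs_nonneg _) ?_ hlim
  filter_upwards [eventually_gt_atTop 0] with t ht
  have ht' : (0 : ℝ) < t := by exact_mod_cast ht
  have hr : 0 < Real.sqrt t := Real.sqrt_pos.2 ht'
  have hrr : Real.sqrt t * Real.sqrt t = t := Real.mul_self_sqrt ht'.le
  -- Pointwise, `2 * |S| * √t ≤ S ^ 2 + t`, which passes from second to first moments.
  have hb : ∀ ω, |(∑ s ∈ Finset.range t, ξ s ω) / t| ≤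
      (2 * Real.sqrt t * t)⁻¹ * ((∑ s ∈ Finset.range t, ξ s ω) ^ 2 + t) := by
    intro ω
    rw [abs_div, abs_of_pos ht', ← sq_abs (∑ s ∈ Finset.range t, ξ s ω), inv_mul_eq_div,
      div_le_div_iff₀ ht' (by positivity)]
    nlinarith [mul_nonneg ht'.le (sq_nonneg (|∑ s ∈ Finset.range t, ξ s ω| - Real.sqrt t))]
  calc ∫ ω, |(∑ s ∈ Finset.range t, ξ s ω) / t| ∂μ
      ≤ ∫ ω, (2 * Real.sqrt t * t)⁻¹ * ((∑ s ∈ Finset.range t, ξ s ω) ^ 2 + t) ∂μ := by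
        refine integral_mono ?_ (((hS t).integrable_sq.add (integrable_const _)).const_mul _) hb
        exact (((hS t).integrable one_le_two).div_const _).abs
    _ = (2 * Real.sqrt t * t)⁻¹ * (∫ ω, (∑ s ∈ Finset.range t, ξ s ω) ^ 2 ∂μ + t) := by
        rw [integral_const_mul, integral_add (hS t).integrable_sq (integrable_const _)]
        simp
    _ ≤ (2 * Real.sqrt t * t)⁻¹ * (t * C + t) := by
        gcongr
        exact hsq t
    _ = (1 + C) / 2 * (Real.sqrt t)⁻¹ := by
        field_simp
        ring

/-- A bounded sequence dominated by half of its own running averages, up to a null sequence,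
tends to zero. -/
theorem tendsto_zero_of_le_half_average {w δ : ℕ → ℝ} {B : ℝ} (hw0 : ∀ t, 0 ≤ w t)
    (hB : ∀ t, w t ≤ B) (hδ : Tendsto δ atTop (nhds 0))
    (h : ∀ t, 0 < t → w t ≤ 1 / 2 * ((∑ s ∈ Finset.range t, w s) / t) + δ t) :
    Tendsto w atTop (nhds 0) := by
  -- An eventual bound `c` improves itself: the finitely many early terms disappear in the average,
  -- so the right side is eventually at most `(c / 4 + c) / 2 + c / 8 = 3 / 4 * c`.
  have step : ∀ c > 0, (∀ᶠ t in atTop, w t ≤ c) → ∀ᶠ t in atTop, w t ≤ 3 / 4 * c := by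
    intro c hc hev
    obtain ⟨N, hN⟩ := eventually_atTop.1 hev
    have hsum : ∀ t, ∑ s ∈ Finset.range t, w s ≤ N * B + t * c := by
      have hB0 : 0 ≤ B := (hw0 0).trans (hB 0)
      intro t
      calc ∑ s ∈ Finset.range t, w s
          ≤ ∑ s ∈ Finset.range t, ((if s < N then B else 0) + c) := by
            refine Finset.sum_le_sum fun s _ => ?_
            split_ifs with hs
            · linarith [hB s]
            · linarith [hN s (not_lt.1 hs)]
        _ = ∑ s ∈ Finset.range t with s < N, B + t * c := by
            rw [Finset.sum_add_distrib, Finset.sum_filter]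
            simp
        _ ≤ N * B + t * c := by
            rw [Finset.sum_const, nsmul_eq_mul]
            gcongr
            calc (Finset.filter (· < N) (Finset.range t)).card ≤ (Finset.range N).card :=
                  Finset.card_le_card fun s hs => by simp at hs ⊢; exact hs.2
              _ = N := Finset.card_range N
    have h1 : ∀ᶠ t : ℕ in atTop, N * B / t < c / 4 :=
      (tendsto_const_div_atTop_nhds_zero_nat (N * B)).eventually_lt_const (by positivity)
    have h2 : ∀ᶠ t in atTop, δ t < c / 8 := hδ.eventually_lt_const (by positivity)
    filter_upwards [h1, h2, eventually_gt_atTop 0] with t h1 h2 ht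
    have ht' : (0 : ℝ) < t := by exact_mod_cast ht
    have h3 : (∑ s ∈ Finset.range t, w s) / t ≤ N * B / t + c := by
      rw [div_le_iff₀ ht', add_mul, div_mul_cancel₀ _ ht'.ne']
      linarith [hsum t]
    linarith [h t ht]
  -- The iteration starts from `B + 1` because `step` needs a positive bound.
  have hpow : ∀ k : ℕ, ∀ᶠ t in atTop, w t ≤ (3 / 4) ^ k * (B + 1) := by
    have hB0 : 0 ≤ B := (hw0 0).trans (hB 0)
    intro k
    induction k with
    | zero => exact .of_forall fun t => by linarith [hB t]
    | succ k ih =>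
      refine (step _ (by positivity) ih).mono fun t ht => ht.trans (le_of_eq ?_)
      ring
  have hk : Tendsto (fun k : ℕ => (3 / 4 : ℝ) ^ k * (B + 1)) atTop (nhds 0) := by
    simpa using (tendsto_pow_atTop_nhds_zero_of_lt_one (by norm_num : (0 : ℝ) ≤ 3 / 4)
      (by norm_num)).mul_const (B + 1)
  rw [tendsto_order]
  refine ⟨fun a ha => .of_forall fun t => ha.trans_le (hw0 t), fun a ha => ?_⟩
  obtain ⟨k, hk⟩ := (hk.eventually_lt_const ha).exists
  exact (hpow k).mono fun t ht => ht.trans_lt hk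

/-! ### Martingale increments of bandit data -/

section Increments

noncomputable section

/-- The indicator that action `a` is chosen in round `t`. -/
def pull {Ω : Type*} {K : ℕ} (A : ℕ → Ω → Fin K) (a : Fin K) (t : ℕ) (ω : Ω) : ℝ :=
  if A t ω = a then 1 else 0

/-- The history of the first `s` rounds, as a part of the history of the first `t` rounds. -/
def History.truncate {d K s t : ℕ} (hst : s ≤ t) (h : History d K t) : History d K s :=
  fun τ => h (Fin.castLE hst τ)

/-- The conditional mean of `1{A_t = a} f(X_t)` given the history. -/
def policyMean {d K : ℕ} (P : Measure (Context d)) (π : BehaviorPolicy d K) (a : Fin K)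
    (f : Context d → ℝ) (t : ℕ) (h : History d K t) : ℝ :=
  ∫ x, π t h x a * f x ∂P

variable {Ω : Type*} {d K : ℕ} {π : BehaviorPolicy d K} {X : ℕ → Ω → Context d} {Ypot : ℕ → Ω → Fin K → ℝ}
  {A : ℕ → Ω → Fin K}

theorem abs_pull_le_one (a : Fin K) (t : ℕ) (ω : Ω) : |pull A a t ω| ≤ 1 := by
  unfold pull
  split_ifs <;> simp

theorem pull_eq_indicator (a : Fin K) (t : ℕ) :
    pull A a t = (A t ⁻¹' {a}).indicator (fun _ => (1 : ℝ)) := by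
  ext ω
  simp only [pull, Set.indicator, Set.mem_preimage, Set.mem_singleton_iff]

variable [MeasurableSpace Ω] {μ : Measure Ω}

theorem IsBanditData.measurable_pull (h : IsBanditData μ π X Ypot A) (a : Fin K) (t : ℕ) :
    Measurable (pull A a t) := by
  rw [pull_eq_indicator]
  exact measurable_const.indicator (h.measurable_action t (measurableSet_singleton a))

theorem IsBanditData.measurable_outcome (h : IsBanditData μ π X Ypot A) (t : ℕ) :
    Measurable (outcome Ypot A t) := by
  have h1 : Measurable fun z : (Fin K → ℝ) × Fin K => z.1 z.2 :=
    measurable_from_prod_countable_left fun a => measurable_pi_apply a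
  exact h1.comp ((h.measurable_potential t).prodMk (h.measurable_action t))

theorem IsBanditData.measurable_history (h : IsBanditData μ π X Ypot A) (t : ℕ) :
    Measurable (history X Ypot A t) :=
  measurable_pi_lambda _ fun τ => (h.measurable_context τ).prodMk
    ((h.measurable_action τ).prodMk (h.measurable_outcome τ))

theorem measurable_truncate {s t : ℕ} (hst : s ≤ t) :
    Measurable (History.truncate (d := d) (K := K) hst) :=
  measurable_pi_lambda _ fun _ => measurable_pi_apply _

theorem IsBanditData.map_context (h : IsBanditData μ π X Ypot A) (t : ℕ) :
    μ.map (X t) = μ.map (X 0) :=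
  ((h.ident t).comp measurable_fst).map_eq

theorem IsBanditData.ae_abs_le (h : IsBanditData μ π X Ypot A) {f : Context d → ℝ}
    (hf : Measurable f) {C : ℝ}
    (hC : ∀ᵐ x ∂(μ.map (X 0)), |f x| ≤ C) (t : ℕ) : ∀ᵐ ω ∂μ, |f (X t ω)| ≤ C := by
  rw [← h.map_context t] at hC
  exact (ae_map_iff (h.measurable_context t).aemeasurable
    (measurableSet_le (by fun_prop) measurable_const)).1 hC

variable [IsProbabilityMeasure μ]

/-- Fubini: the current context is independent of the history, and its law is the same in every
round. -/
theorem IsBanditData.integral_history_context (h : IsBanditData μ π X Ypot A) (t : ℕ)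
    {g : History d K t × Context d → ℝ} (hg : Measurable g)
    (hint : Integrable (fun ω => g (history X Ypot A t ω, X t ω)) μ) :
    ∫ ω, g (history X Ypot A t ω, X t ω) ∂μ =
      ∫ ω, ∫ x, g (history X Ypot A t ω, x) ∂(μ.map (X 0)) ∂μ := by
  have hH := h.measurable_history t
  have hX := h.measurable_context t
  have hind : IndepFun (history X Ypot A t) (X t) μ :=
    ((h.indep_history t).comp measurable_fst measurable_id).symm
  have hprod := (indepFun_iff_map_prod_eq_prod_map_map hH.aemeasurable hX.aemeasurable).1 hind
  have hm : Measurable fun ω => (history X Ypot A t ω, X t ω) := hH.prodMk hX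
  have hint' : Integrable g ((μ.map (history X Ypot A t)).prod (μ.map (X t))) := by
    rw [← hprod]
    exact (integrable_map_measure hg.aestronglyMeasurable hm.aemeasurable).2 hint
  have : IsProbabilityMeasure (μ.map (X t)) := Measure.isProbabilityMeasure_map hX.aemeasurable
  have : IsProbabilityMeasure (μ.map (history X Ypot A t)) :=
    Measure.isProbabilityMeasure_map hH.aemeasurable
  rw [← integral_map (φ := fun ω => (history X Ypot A t ω, X t ω)) hm.aemeasurable
    hg.aestronglyMeasurable, hprod, integral_prod _ hint', ← h.map_context t,
    integral_map hH.aemeasurable]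
  exact hg.stronglyMeasurable.integral_prod_right'.aestronglyMeasurable

theorem measurable_policyMean {P : Measure (Context d)} [IsProbabilityMeasure P] {t : ℕ}
    {a : Fin K} (hπm : Measurable fun z : History d K t × Context d => π t z.1 z.2 a)
    {f : Context d → ℝ} (hf : Measurable f) : Measurable (policyMean P π a f t) := by
  have h1 : Measurable fun z : History d K t × Context d => π t z.1 z.2 a * f z.2 := by fun_prop
  exact h1.stronglyMeasurable.integral_prod_right'.measurable

theorem abs_policyMean_le {P : Measure (Context d)} [IsProbabilityMeasure P] {t : ℕ}
    {a : Fin K} (hπ0 : ∀ h x, 0 ≤ π t h x a) (hπ1 : ∀ h x, π t h x a ≤ 1)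
    {f : Context d → ℝ} {C : ℝ} (hC : ∀ᵐ x ∂P, |f x| ≤ C) (h : History d K t) :
    |policyMean P π a f t h| ≤ C := by
  have hb : ∀ᵐ x ∂P, ‖π t h x a * f x‖ ≤ C := by
    filter_upwards [hC] with x hx
    rw [Real.norm_eq_abs, abs_mul, abs_of_nonneg (hπ0 h x)]
    exact (mul_le_of_le_one_left (abs_nonneg _) (hπ1 h x)).trans hx
  simpa [policyMean] using norm_integral_le_of_norm_le_const hb

/-- The martingale difference property in weak form. The action is averaged out first, through
`action_law`, and then the context, through its independence of the history. -/
theorem IsBanditData.integral_mul_increment (h : IsBanditData μ π X Ypot A) {t : ℕ} {a : Fin K}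
    (hπm : Measurable fun z : History d K t × Context d => π t z.1 z.2 a)
    (hπ0 : ∀ h x, 0 ≤ π t h x a) (hπ1 : ∀ h x, π t h x a ≤ 1)
    {f : Context d → ℝ} (hf : Measurable f) {C : ℝ} (hC : ∀ᵐ x ∂(μ.map (X 0)), |f x| ≤ C)
    {z : History d K t → ℝ} (hz : Measurable z)
    (hzi : Integrable (fun ω => z (history X Ypot A t ω)) μ) :
    ∫ ω, z (history X Ypot A t ω) * (pull A a t ω * f (X t ω) -
      policyMean (μ.map (X 0)) π a f t (history X Ypot A t ω)) ∂μ = 0 := by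
  have hX := h.measurable_context t
  have hH := h.measurable_history t
  have : IsProbabilityMeasure (μ.map (X 0)) :=
    Measure.isProbabilityMeasure_map (h.measurable_context 0).aemeasurable
  have hCX := h.ae_abs_le hf hC t
  have hzf : Integrable (fun ω => z (history X Ypot A t ω) * f (X t ω)) μ :=
    hzi.mul_bdd (c := C) (hf.comp hX).aestronglyMeasurable (by simpa using hCX)
  have hp := h.measurable_pull a t
  have i1 : Integrable (fun ω => z (history X Ypot A t ω) * f (X t ω) * pull A a t ω) μ :=
    hzf.mul_bdd (c := 1) hp.aestronglyMeasurable (.of_forall fun ω => abs_pull_le_one a t ω)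
  have i2 : Integrable (fun ω => z (history X Ypot A t ω) *
      policyMean (μ.map (X 0)) π a f t (history X Ypot A t ω)) μ :=
    hzi.mul_bdd (c := C) ((measurable_policyMean hπm hf).comp hH).aestronglyMeasurable
      (.of_forall fun ω => abs_policyMean_le hπ0 hπ1 hC _)
  have i3 : Integrable (fun ω => z (history X Ypot A t ω) * f (X t ω) *
      π t (history X Ypot A t ω) (X t ω) a) μ :=
    hzf.mul_bdd (c := 1) (hπm.comp (hH.prodMk hX)).aestronglyMeasurable
      (.of_forall fun ω => by
        rw [Real.norm_of_nonneg (hπ0 _ _)]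
        exact hπ1 _ _)
  -- conditioning on the history, the context and the potential outcomes
  have e1 : ∫ ω, z (history X Ypot A t ω) * f (X t ω) * pull A a t ω ∂μ =
      ∫ ω, z (history X Ypot A t ω) * f (X t ω) * π t (history X Ypot A t ω) (X t ω) a ∂μ := by
    let V : Ω → History d K t × Context d × (Fin K → ℝ) :=
      fun ω => (history X Ypot A t ω, X t ω, Ypot t ω)
    have hV : Measurable V := hH.prodMk (hX.prodMk (h.measurable_potential t))
    have hsm : StronglyMeasurable[MeasurableSpace.comap V inferInstance]
        (fun ω => z (history X Ypot A t ω) * f (X t ω)) := by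
      have : Measurable fun v : History d K t × Context d × (Fin K → ℝ) => z v.1 * f v.2.1 := by
        fun_prop
      exact (this.comp (comap_measurable V)).stronglyMeasurable
    have ip : Integrable (pull A a t) μ :=
      Integrable.of_bound hp.aestronglyMeasurable 1 (.of_forall fun ω => abs_pull_le_one a t ω)
    have hce := condExp_mul_of_stronglyMeasurable_left hsm i1 ip
    have hlaw := h.action_law t a
    rw [← pull_eq_indicator] at hlaw
    rw [← integral_condExp (m := MeasurableSpace.comap V inferInstance) hV.comap_le]
    refine integral_congr_ae ?_
    filter_upwards [hce, hlaw] with ω h1 h2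
    have h1' := h1
    rw [Pi.mul_apply] at h1'
    refine h1'.trans ?_
    rw [← h2]
  have e2 : ∫ ω, z (history X Ypot A t ω) * f (X t ω) *
        π t (history X Ypot A t ω) (X t ω) a ∂μ =
      ∫ ω, z (history X Ypot A t ω) *
        policyMean (μ.map (X 0)) π a f t (history X Ypot A t ω) ∂μ := by
    have := h.integral_history_context t
      (g := fun v => z v.1 * f v.2 * π t v.1 v.2 a) (by fun_prop) i3
    rw [this]
    congr 1 with ω : 1
    rw [policyMean, ← integral_const_mul]
    congr 1 with x : 1
    ring
  have e3 : ∀ ω, z (history X Ypot A t ω) * (pull A a t ω * f (X t ω) -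
      policyMean (μ.map (X 0)) π a f t (history X Ypot A t ω)) =
      z (history X Ypot A t ω) * f (X t ω) * pull A a t ω - z (history X Ypot A t ω) *
        policyMean (μ.map (X 0)) π a f t (history X Ypot A t ω) := fun ω => by ring
  simp_rw [e3]
  rw [integral_sub i1 i2, e1, e2, sub_self]

/-- Law of large numbers for adaptively drawn actions: centring at the conditional means makes the
increments orthogonal, however the policy changes over time. -/
theorem IsBanditData.tendstoZeroInMean_average (h : IsBanditData μ π X Ypot A) {a : Fin K}
    (hπm : ∀ t, Measurable fun z : History d K t × Context d => π t z.1 z.2 a)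
    (hπ0 : ∀ t h x, 0 ≤ π t h x a) (hπ1 : ∀ t h x, π t h x a ≤ 1)
    {f : Context d → ℝ} (hf : Measurable f) {C : ℝ} (hC : ∀ᵐ x ∂(μ.map (X 0)), |f x| ≤ C) :
    TendstoZeroInMean μ fun t ω => (∑ s ∈ Finset.range t, (pull A a s ω * f (X s ω) -
      policyMean (μ.map (X 0)) π a f s (history X Ypot A s ω))) / t := by
  have : IsProbabilityMeasure (μ.map (X 0)) :=
    Measure.isProbabilityMeasure_map (h.measurable_context 0).aemeasurable
  have hpm : ∀ s, Measurable (policyMean (μ.map (X 0)) π a f s) := fun s =>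
    measurable_policyMean (hπm s) hf
  have hmeas : ∀ s, Measurable fun ω => pull A a s ω * f (X s ω) -
      policyMean (μ.map (X 0)) π a f s (history X Ypot A s ω) := fun s =>
    ((h.measurable_pull a s).mul (hf.comp (h.measurable_context s))).sub
      ((hpm s).comp (h.measurable_history s))
  have hbd : ∀ s, ∀ᵐ ω ∂μ, ‖pull A a s ω * f (X s ω) -
      policyMean (μ.map (X 0)) π a f s (history X Ypot A s ω)‖ ≤ 2 * C := by
    intro s
    filter_upwards [h.ae_abs_le hf hC s] with ω hω
    refine (norm_sub_le _ _).trans ?_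
    have h1 : ‖pull A a s ω * f (X s ω)‖ ≤ C := by
      rw [norm_mul]
      exact (mul_le_of_le_one_left (norm_nonneg _) (abs_pull_le_one a s ω)).trans hω
    have h2 := abs_policyMean_le (hπ0 s) (hπ1 s) hC (history X Ypot A s ω)
    rw [Real.norm_eq_abs (policyMean _ _ _ _ _ _)]
    linarith
  have hL2 : ∀ s, MemLp (fun ω => pull A a s ω * f (X s ω) -
      policyMean (μ.map (X 0)) π a f s (history X Ypot A s ω)) 2 μ := fun s =>
    MemLp.of_bound (hmeas s).aestronglyMeasurable (2 * C) (hbd s)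
  refine tendstoZeroInMean_average_of_orthogonal hL2 (C := (2 * C) ^ 2) (fun s => ?_) fun s t hst => ?_
  · have hb : ∀ᵐ ω ∂μ, ‖(pull A a s ω * f (X s ω) -
        policyMean (μ.map (X 0)) π a f s (history X Ypot A s ω)) ^ 2‖ ≤ (2 * C) ^ 2 := by
      filter_upwards [hbd s] with ω hω
      rw [norm_pow]
      gcongr
    exact (le_abs_self _).trans (by simpa using norm_integral_le_of_norm_le_const hb)
  -- Since `s < t`, the increment of round `s` is a function of the history before round `t`.
  · let z : History d K t → ℝ := fun η => (if (η ⟨s, hst⟩).2.1 = a then 1 else 0) *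
      f (η ⟨s, hst⟩).1 - policyMean (μ.map (X 0)) π a f s (η.truncate hst.le)
    have hz : Measurable z := by
      refine Measurable.sub (Measurable.mul ?_ ?_) ((hpm s).comp (measurable_truncate hst.le))
      · refine Measurable.ite (measurableSet_eq_fun ?_ measurable_const) measurable_const
          measurable_const
        fun_prop
      · fun_prop
    exact h.integral_mul_increment (hπm t) (hπ0 t) (hπ1 t) hf hC hz
      ((hL2 s).integrable one_le_two)

/-- Here orthogonality comes from conditioning on the history, the context and the action, given
which the current noise has mean zero. -/
theorem IsBanditData.tendstoZeroInMean_average_noise (h : IsBanditData μ π X Ypot A)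
    {y : Context d → Fin K → ℝ} (hy : ∀ a, Measurable fun x => y x a) {σ : ℝ}
    (hL2 : ∀ t, MemLp (noise y X Ypot A t) 2 μ)
    (hmean : ∀ t, μ[noise y X Ypot A t | MeasurableSpace.comap
      (fun ω => (history X Ypot A t ω, X t ω, A t ω)) inferInstance] =ᵐ[μ] 0)
    (hvar : ∀ t, ∫ ω, noise y X Ypot A t ω ^ 2 ∂μ ≤ σ)
    (a : Fin K) {f : Context d → ℝ} (hf : Measurable f) {C : ℝ}
    (hC : ∀ᵐ x ∂(μ.map (X 0)), |f x| ≤ C) :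
    TendstoZeroInMean μ fun t ω => (∑ s ∈ Finset.range t,
      pull A a s ω * f (X s ω) * noise y X Ypot A s ω) / t := by
  have hyu : Measurable fun z : Context d × Fin K => y z.1 z.2 :=
    measurable_from_prod_countable_left hy
  have hcm : ∀ s, Measurable fun ω => pull A a s ω * f (X s ω) := fun s =>
    (h.measurable_pull a s).mul (hf.comp (h.measurable_context s))
  have hcb : ∀ s, ∀ᵐ ω ∂μ, ‖pull A a s ω * f (X s ω)‖ ≤ C := by
    intro s
    filter_upwards [h.ae_abs_le hf hC s] with ω hω
    rw [norm_mul]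
    exact (mul_le_of_le_one_left (norm_nonneg _) (abs_pull_le_one a s ω)).trans hω
  have hξ : ∀ s, MemLp (fun ω => pull A a s ω * f (X s ω) * noise y X Ypot A s ω) 2 μ := by
    intro s
    refine MemLp.of_le_mul (c := C) (hL2 s)
      ((hcm s).aestronglyMeasurable.mul (hL2 s).aestronglyMeasurable) ?_
    filter_upwards [hcb s] with ω hω
    rw [norm_mul]
    gcongr
  refine tendstoZeroInMean_average_of_orthogonal hξ (C := C ^ 2 * σ) (fun s => ?_) fun s t hst => ?_
  · refine le_trans ?_ (mul_le_mul_of_nonneg_left (hvar s) (sq_nonneg C))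
    rw [← integral_const_mul]
    refine integral_mono_ae (hξ s).integrable_sq ((hL2 s).integrable_sq.const_mul _) ?_
    filter_upwards [hcb s] with ω hω
    rw [mul_pow, ← sq_abs (pull A a s ω * f (X s ω))]
    rw [Real.norm_eq_abs] at hω
    gcongr
  · let V : Ω → History d K t × Context d × Fin K :=
      fun ω => (history X Ypot A t ω, X t ω, A t ω)
    have hV : Measurable V := (h.measurable_history t).prodMk
      ((h.measurable_context t).prodMk (h.measurable_action t))
    -- Everything in the product except the current noise: the whole term of round `s`, whose noise
    -- is read off the recorded outcome, and the coefficient of round `t`.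
    let u : History d K t × Context d × Fin K → ℝ := fun v =>
      (if (v.1 ⟨s, hst⟩).2.1 = a then 1 else 0) * f (v.1 ⟨s, hst⟩).1 *
        ((v.1 ⟨s, hst⟩).2.2 - y (v.1 ⟨s, hst⟩).1 (v.1 ⟨s, hst⟩).2.1) *
        ((if v.2.2 = a then 1 else 0) * f v.2.1)
    have hu : Measurable u := by
      have m1 : Measurable fun v : History d K t × Context d × Fin K => (v.1 ⟨s, hst⟩).1 := by
        fun_prop
      have m2 : Measurable fun v : History d K t × Context d × Fin K => (v.1 ⟨s, hst⟩).2.1 := by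
        fun_prop
      have m3 : Measurable fun v : History d K t × Context d × Fin K => (v.1 ⟨s, hst⟩).2.2 := by
        fun_prop
      have m4 : Measurable fun v : History d K t × Context d × Fin K => v.2.2 := by fun_prop
      refine Measurable.mul (Measurable.mul (Measurable.mul ?_ (hf.comp m1))
        (m3.sub (hyu.comp (m1.prodMk m2)))) (Measurable.mul ?_ (by fun_prop))
      · exact Measurable.ite (measurableSet_eq_fun m2 measurable_const) measurable_const
          measurable_const
      · exact Measurable.ite (measurableSet_eq_fun m4 measurable_const) measurable_const
          measurable_const
    have hsm : StronglyMeasurable[MeasurableSpace.comap V inferInstance] (fun ω => u (V ω)) :=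
      (hu.comp (comap_measurable V)).stronglyMeasurable
    have e : ∀ ω, pull A a s ω * f (X s ω) * noise y X Ypot A s ω *
        (pull A a t ω * f (X t ω) * noise y X Ypot A t ω) =
        u (V ω) * noise y X Ypot A t ω := fun ω => by
      rw [← mul_assoc]
      rfl
    have hint : Integrable (fun ω => u (V ω) * noise y X Ypot A t ω) μ := by
      simp_rw [← e]
      exact (hξ s).integrable_mul (hξ t)
    have hce := condExp_mul_of_stronglyMeasurable_left hsm hint ((hL2 t).integrable one_le_two)
    simp_rw [e]
    rw [← integral_condExp (m := MeasurableSpace.comap V inferInstance) hV.comap_le]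
    refine (integral_congr_ae ?_).trans (integral_zero Ω ℝ)
    filter_upwards [hce, hmean t] with ω h1 h2
    refine h1.trans ?_
    rw [Pi.mul_apply]
    refine (congrArg (u (V ω) * ·) h2).trans ?_
    simp

end

end Increments

/-! ### The ridge estimator -/

section Ridge

variable {d K t : ℕ} {lam : ℝ}

theorem posDef_ridgeGram (hlam : 0 < lam) (h : History d K t) (a : Fin K) :
    (ridgeGram lam h a).PosDef := by
  unfold ridgeGram
  refine Matrix.PosDef.add_posSemidef (Matrix.PosDef.one.smul hlam)
    (Matrix.posSemidef_sum _ fun τ _ => ?_)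
  split_ifs
  · simpa using Matrix.posSemidef_vecMulVec_self_star (WithLp.ofLp (h τ).1)
  · exact Matrix.PosSemidef.zero

theorem ridgeGram_mulVec_ridge (hlam : 0 < lam) (h : History d K t) (a : Fin K) :
    (ridgeGram lam h a).mulVec (WithLp.ofLp (ridge lam h a)) = ridgeCross h a := by
  have hu := (Matrix.isUnit_iff_isUnit_det _).1 (posDef_ridgeGram hlam h a).isUnit
  simp [ridge, Matrix.mulVec_mulVec, Matrix.mul_nonsing_inv _ hu]

/-- The normal equations of ridge regression. -/
theorem ridge_normal_equations (hlam : 0 < lam) (h : History d K t) (a : Fin K) :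
    lam • ridge lam h a +
      ∑ τ : Fin t, (if (h τ).2.1 = a then (1 : ℝ) else 0) •
        ((inner ℝ (ridge lam h a) (h τ).1 : ℝ) • (h τ).1) =
      ∑ τ : Fin t, (if (h τ).2.1 = a then (1 : ℝ) else 0) • ((h τ).2.2 • (h τ).1) := by
  have h1 := ridgeGram_mulVec_ridge hlam h a
  ext i
  have h2 := congrFun h1 i
  have e : ∀ τ : Fin t, ((if (h τ).2.1 = a then
      Matrix.vecMulVec (WithLp.ofLp (h τ).1) (WithLp.ofLp (h τ).1) else 0).mulVec
        (WithLp.ofLp (ridge lam h a))) i =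
      (if (h τ).2.1 = a then (1 : ℝ) else 0) *
        ((inner ℝ (ridge lam h a) (h τ).1 : ℝ) * (h τ).1 i) := by
    intro τ
    split_ifs
    · rw [Matrix.vecMulVec_mulVec, EuclideanSpace.inner_eq_star_dotProduct]
      simp [mul_comm]
    · simp
  have e' : ∀ τ : Fin t, (if (h τ).2.1 = a then (h τ).2.2 • WithLp.ofLp (h τ).1 else 0) i =
      (if (h τ).2.1 = a then (1 : ℝ) else 0) * ((h τ).2.2 * (h τ).1 i) := by
    intro τ
    split_ifs <;> simp
  rw [ridgeGram, ridgeCross, Matrix.add_mulVec, Matrix.smul_mulVec, Matrix.one_mulVec,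
    Matrix.sum_mulVec] at h2
  simp only [Pi.add_apply, Finset.sum_apply, e, e', Pi.smul_apply, smul_eq_mul] at h2
  simpa only [PiLp.add_apply, PiLp.smul_apply, WithLp.ofLp_sum, Finset.sum_apply, smul_eq_mul]
    using h2

/-- The normal equations centred at `θ` and paired with the error. With `θ` the population
coefficients, the right side is a residual that can be averaged. -/
theorem ridge_error_equation (hlam : 0 < lam) (h : History d K t) (a : Fin K) (θ : Context d) :
    lam * ‖ridge lam h a - θ‖ ^ 2 + ∑ τ : Fin t, (if (h τ).2.1 = a then (1 : ℝ) else 0) *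
        (inner ℝ (ridge lam h a - θ) (h τ).1) ^ 2 =
      inner ℝ (ridge lam h a - θ) (-(lam • θ) + ∑ τ : Fin t,
        (if (h τ).2.1 = a then (1 : ℝ) else 0) •
          (((h τ).2.2 - inner ℝ θ (h τ).1) • (h τ).1)) := by
  have h1 := ridge_normal_equations hlam h a
  set e := ridge lam h a - θ with he
  have h2 : -(lam • θ) + ∑ τ : Fin t, (if (h τ).2.1 = a then (1 : ℝ) else 0) •
      (((h τ).2.2 - inner ℝ θ (h τ).1) • (h τ).1) =
      lam • e + ∑ τ : Fin t, (if (h τ).2.1 = a then (1 : ℝ) else 0) •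
        ((inner ℝ e (h τ).1 : ℝ) • (h τ).1) := by
    have h3 : ∑ τ : Fin t, (if (h τ).2.1 = a then (1 : ℝ) else 0) •
        (((h τ).2.2 - inner ℝ θ (h τ).1) • (h τ).1) =
        ∑ τ : Fin t, (if (h τ).2.1 = a then (1 : ℝ) else 0) • ((h τ).2.2 • (h τ).1) -
        ∑ τ : Fin t, (if (h τ).2.1 = a then (1 : ℝ) else 0) •
          ((inner ℝ θ (h τ).1 : ℝ) • (h τ).1) := by
      rw [← Finset.sum_sub_distrib]
      exact Finset.sum_congr rfl fun τ _ => by rw [sub_smul, smul_sub]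
    have h4 : ∑ τ : Fin t, (if (h τ).2.1 = a then (1 : ℝ) else 0) •
        ((inner ℝ e (h τ).1 : ℝ) • (h τ).1) =
        ∑ τ : Fin t, (if (h τ).2.1 = a then (1 : ℝ) else 0) •
          ((inner ℝ (ridge lam h a) (h τ).1 : ℝ) • (h τ).1) -
        ∑ τ : Fin t, (if (h τ).2.1 = a then (1 : ℝ) else 0) •
          ((inner ℝ θ (h τ).1 : ℝ) • (h τ).1) := by
      rw [← Finset.sum_sub_distrib]
      exact Finset.sum_congr rfl fun τ _ => by rw [he, inner_sub_left, sub_smul, smul_sub]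
    rw [h3, h4, ← h1, he, smul_sub]
    abel
  rw [h2, inner_add_right, inner_smul_right, real_inner_self_eq_norm_sq, inner_sum]
  congr 1
  refine Finset.sum_congr rfl fun τ _ => ?_
  rw [inner_smul_right, inner_smul_right]
  ring

/-- The entries of the inverse are the adjugate entries divided by the determinant, all polynomial
in the Gram entries. -/
theorem measurable_ridge (lam : ℝ) :
    Measurable fun h : History d K t => ridge lam h := by
  refine measurable_pi_lambda _ fun a => ?_
  have hc : ∀ (τ : Fin t) (i : Fin d), Measurable fun h : History d K t => (h τ).1 i := by
    intro τ i
    have h1 : Measurable fun h : History d K t => (h τ).1 := by fun_prop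
    fun_prop
  have hset : ∀ τ : Fin t, MeasurableSet {h : History d K t | (h τ).2.1 = a} := fun τ =>
    measurableSet_eq_fun (by fun_prop) measurable_const
  have hcross : ∀ i, Measurable fun h : History d K t => ridgeCross h a i := by
    intro i
    simp only [ridgeCross, Finset.sum_apply]
    refine Finset.measurable_sum _ fun τ _ => ?_
    have e : (fun h : History d K t =>
        (if (h τ).2.1 = a then (h τ).2.2 • WithLp.ofLp (h τ).1 else 0) i) =
        fun h => if (h τ).2.1 = a then (h τ).2.2 * (h τ).1 i else 0 := by
      ext h
      split_ifs <;> simp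
    rw [e]
    refine Measurable.ite (hset τ) (Measurable.mul ?_ (hc τ i)) measurable_const
    fun_prop
  let gram : History d K t → Fin d → Fin d → ℝ := fun h => ridgeGram lam h a
  have hgram : Measurable gram := by
    refine measurable_pi_lambda _ fun i => measurable_pi_lambda _ fun j => ?_
    have e : (fun h : History d K t => ridgeGram lam h a i j) =
        fun h => lam * (1 : Matrix (Fin d) (Fin d) ℝ) i j +
          ∑ τ : Fin t, if (h τ).2.1 = a then (h τ).1 i * (h τ).1 j else 0 := by
      ext h
      simp only [ridgeGram, Matrix.add_apply, Matrix.smul_apply, smul_eq_mul, Matrix.sum_apply]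
      congr 1
      refine Finset.sum_congr rfl fun τ _ => ?_
      split_ifs <;> simp [Matrix.vecMulVec_apply]
    rw [e]
    exact measurable_const.add (Finset.measurable_sum _ fun τ _ =>
      Measurable.ite (hset τ) ((hc τ i).mul (hc τ j)) measurable_const)
  have hdet : Measurable fun h : History d K t => (ridgeGram lam h a).det := by
    have h1 : Continuous fun B : Fin d → Fin d → ℝ => Matrix.det B :=
      Continuous.matrix_det continuous_id
    exact h1.measurable.comp hgram
  have hadj : ∀ i j, Measurable fun h : History d K t => (ridgeGram lam h a).adjugate i j := by
    intro i j
    have h1 : Continuous fun B : Fin d → Fin d → ℝ => Matrix.adjugate B i j :=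
      (Continuous.matrix_adjugate continuous_id).matrix_elem i j
    exact h1.measurable.comp hgram
  have hcomp : Measurable fun h : History d K t =>
      (ridgeGram lam h a)⁻¹.mulVec (ridgeCross h a) := by
    refine measurable_pi_lambda _ fun i => ?_
    simp only [Matrix.mulVec, dotProduct, Matrix.inv_def, Ring.inverse_eq_inv',
      Matrix.smul_apply, smul_eq_mul]
    exact Finset.measurable_sum _ fun j _ => (hdet.inv.mul (hadj i j)).mul (hcross j)
  exact (WithLp.measurable_toLp 2 _).comp hcomp

end Ridge

/-! ### Inequalities for truncated errors -/

theorem norm_le_sum_abs {d : ℕ} (v : Context d) : ‖v‖ ≤ ∑ i, |v i| := by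
  rw [EuclideanSpace.norm_eq]
  refine Real.sqrt_le_iff.2 ⟨Finset.sum_nonneg fun i _ => abs_nonneg _, ?_⟩
  exact Finset.sum_sq_le_sq_sum_of_nonneg fun i _ => norm_nonneg _

theorem min_norm_pi_le {ι : Type*} [Fintype ι] {E : ι → Type*}
    [∀ i, SeminormedAddCommGroup (E i)] {v : ∀ i, E i} {B r : ℝ} (hr : 0 ≤ r)
    (h : ∀ i, min ‖v i‖ B ≤ r) : min ‖v‖ B ≤ r := by
  by_cases hB : B ≤ r
  · exact (min_le_right _ _).trans hB
  · refine (min_le_left _ _).trans ((pi_norm_le_iff_of_nonneg hr).2 fun i => ?_)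
    exact (min_le_iff.1 (h i)).resolve_right hB

/-- If the Gram error `G` is at most half of `t * s'`, dividing by `t * s' / 2` turns the factor `s'
/ 4` into `1 / 2`. Otherwise `2 * B / s' * (G / t)` already exceeds the truncation level, so no
separate estimate of this bad event is needed. -/
theorem min_le_half_average {s' t e B G N S : ℝ} (hs : 0 < s') (ht : 0 < t) (he : 0 ≤ e)
    (hB : 0 ≤ B) (hG : 0 ≤ G) (hN : 0 ≤ N) (hS : 0 ≤ S)
    (h : (t * s' - G) * e ≤ N + s' / 4 * S) :
    min e B ≤ 1 / 2 * (S / t) + (2 / s' * (N / t) + 2 * B / s' * (G / t)) := by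
  by_cases hc : G ≤ t * s' / 2
  · refine (min_le_left _ _).trans ?_
    have h1 : t * s' / 2 * e ≤ N + s' / 4 * S := le_trans (by gcongr; linarith) h
    have h2 : e ≤ 1 / 2 * (S / t) + 2 / s' * (N / t) := by
      have : 1 / 2 * (S / t) + 2 / s' * (N / t) = (N + s' / 4 * S) / (t * s' / 2) := by
        field_simp
        ring
      rw [this, le_div_iff₀ (by positivity)]
      linarith
    have h3 : 0 ≤ 2 * B / s' * (G / t) := by positivity
    linarith
  · refine (min_le_right _ _).trans ?_
    have h1 : B ≤ 2 * B / s' * (G / t) := by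
      rw [div_mul_div_comm, le_div_iff₀ (by positivity)]
      push Not at hc
      nlinarith
    have h2 : 0 ≤ 1 / 2 * (S / t) := by positivity
    have h3 : 0 ≤ 2 / s' * (N / t) := by positivity
    linarith

/-! ### Decomposition of the estimation error -/

theorem inner_sq_eq_sum {d : ℕ} (v x : Context d) :
    inner ℝ v x ^ 2 = ∑ i, ∑ j, v i * v j * (x i * x j) := by
  rw [PiLp.inner_apply, sq, Finset.sum_mul_sum]
  refine Finset.sum_congr rfl fun i _ => Finset.sum_congr rfl fun j _ => ?_
  simp only [RCLike.inner_apply, conj_trivial]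
  ring

theorem abs_apply_le_norm {d : ℕ} (x : Context d) (i : Fin d) : |x i| ≤ ‖x‖ := by
  simpa using PiLp.norm_apply_le x i

/-- The entrywise bound is uniform in `v`, which matters because `v` will be the estimation error
and so depends on the same data as `G`. -/
theorem abs_sum_sum_mul_le {d : ℕ} (v : Context d) (G : Fin d → Fin d → ℝ) :
    |∑ i, ∑ j, v i * v j * G i j| ≤ (∑ i, ∑ j, |G i j|) * ‖v‖ ^ 2 := by
  rw [Finset.sum_mul]
  refine (Finset.abs_sum_le_sum_abs _ _).trans (Finset.sum_le_sum fun i _ => ?_)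
  rw [Finset.sum_mul]
  refine (Finset.abs_sum_le_sum_abs _ _).trans (Finset.sum_le_sum fun j _ => ?_)
  rw [abs_mul, abs_mul, mul_comm, sq]
  have h1 := abs_apply_le_norm v i
  have h2 := abs_apply_le_norm v j
  gcongr

section Decomposition

variable {d : ℕ} {P : Measure (Context d)} [IsProbabilityMeasure P] {M Ry : ℝ}
  {w f : Context d → ℝ}

theorem integral_weight_inner_sq (hM : ∀ᵐ x ∂P, ‖x‖ ≤ M) (hw : Measurable w)
    (hw0 : ∀ x, 0 ≤ w x) (hw1 : ∀ x, w x ≤ 1) (v : Context d) :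
    ∫ x, w x * inner ℝ v x ^ 2 ∂P = ∑ i, ∑ j, v i * v j * ∫ x, w x * (x i * x j) ∂P := by
  have hint : ∀ i j : Fin d, Integrable (fun x => v i * v j * (w x * (x i * x j))) P := by
    intro i j
    refine Integrable.const_mul ?_ _
    refine Integrable.of_bound (Measurable.aestronglyMeasurable (by fun_prop)) (M * M) ?_
    filter_upwards [hM] with x hx
    have h1 := (abs_apply_le_norm x i).trans hx
    have h2 := (abs_apply_le_norm x j).trans hx
    have hM0 := (norm_nonneg x).trans hx
    rw [Real.norm_eq_abs, abs_mul, abs_of_nonneg (hw0 x), abs_mul]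
    refine (mul_le_of_le_one_left (by positivity) (hw1 x)).trans ?_
    gcongr
  have e : ∀ x, w x * inner ℝ v x ^ 2 = ∑ i, ∑ j, v i * v j * (w x * (x i * x j)) := by
    intro x
    rw [inner_sq_eq_sum, Finset.mul_sum]
    refine Finset.sum_congr rfl fun i _ => ?_
    rw [Finset.mul_sum]
    exact Finset.sum_congr rfl fun j _ => by ring
  simp_rw [e]
  rw [integral_finsetSum _ fun i _ => integrable_finsetSum _ fun j _ => hint i j]
  refine Finset.sum_congr rfl fun i _ => ?_
  rw [integral_finsetSum _ fun j _ => hint i j]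
  exact Finset.sum_congr rfl fun j _ => integral_const_mul _ _

theorem score_apply (hM : ∀ᵐ x ∂P, ‖x‖ ≤ M) (hw : Measurable w) (hw0 : ∀ x, 0 ≤ w x)
    (hw1 : ∀ x, w x ≤ 1) (hfm : Measurable f) (hf : ∀ x, ‖x‖ ≤ M → |f x| ≤ Ry) (θ : Context d)
    (i : Fin d) : score P w f θ i = ∫ x, w x * (x i * (f x - inner ℝ θ x)) ∂P := by
  have h := (EuclideanSpace.proj (𝕜 := ℝ) i : Context d →L[ℝ] ℝ).integral_comp_comm
    (integrable_score hM hw hw0 hw1 hfm hf θ)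
  simp only [PiLp.proj_apply, PiLp.smul_apply, smul_eq_mul] at h
  rw [score, ← h]
  congr 1 with x : 1
  ring

end Decomposition

/-! ### Error terms and the recursive inequality -/

noncomputable section

/-- The average of the increments of `1{A_t = a} f(X_t)`. -/
def armError {Ω : Type*} {d K : ℕ} (P : Measure (Context d)) (π : BehaviorPolicy d K)
    (X : ℕ → Ω → Context d) (Ypot : ℕ → Ω → Fin K → ℝ) (A : ℕ → Ω → Fin K) (a : Fin K)
    (f : Context d → ℝ) (t : ℕ) (ω : Ω) : ℝ :=
  (∑ s ∈ Finset.range t, (pull A a s ω * f (X s ω) -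
    policyMean P π a f s (history X Ypot A s ω))) / t

/-- The average of `1{A_t = a} f(X_t) η_t`. -/
def noiseError {Ω : Type*} {d K : ℕ} (y : Context d → Fin K → ℝ)
    (X : ℕ → Ω → Context d) (Ypot : ℕ → Ω → Fin K → ℝ) (A : ℕ → Ω → Fin K) (a : Fin K)
    (f : Context d → ℝ) (t : ℕ) (ω : Ω) : ℝ :=
  (∑ s ∈ Finset.range t, pull A a s ω * f (X s ω) * noise y X Ypot A s ω) / t

/-- The total Gram matrix error of an action. -/
def gramError {Ω : Type*} {d K : ℕ} (P : Measure (Context d)) (π : BehaviorPolicy d K)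
    (X : ℕ → Ω → Context d) (Ypot : ℕ → Ω → Fin K → ℝ) (A : ℕ → Ω → Fin K) (a : Fin K)
    (t : ℕ) (ω : Ω) : ℝ :=
  ∑ i, ∑ j, |armError P π X Ypot A a (fun x => x i * x j) t ω|

/-- The total cross product error of an action, for the reference coefficients `θ`. -/
def crossError {Ω : Type*} {d K : ℕ} (P : Measure (Context d)) (π : BehaviorPolicy d K)
    (y : Context d → Fin K → ℝ)
    (X : ℕ → Ω → Context d) (Ypot : ℕ → Ω → Fin K → ℝ) (A : ℕ → Ω → Fin K) (a : Fin K)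
    (θ : Context d) (t : ℕ) (ω : Ω) : ℝ :=
  ∑ i, (|noiseError y X Ypot A a (fun x => x i) t ω| +
    |armError P π X Ypot A a (fun x => x i * (y x a - inner ℝ θ x)) t ω|)

section Main

variable {Ω : Type*} {d K : ℕ} [NeZero K] {P : Measure (Context d)} [IsProbabilityMeasure P]
  {X : ℕ → Ω → Context d} {Ypot : ℕ → Ω → Fin K → ℝ} {A : ℕ → Ω → Fin K}
  {y : Context d → Fin K → ℝ} {M s₀ Ry lam πmin γ : ℝ}

/-- Each term is replaced by its conditional mean given the history, which clipping bounds below;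
the replacement costs the Gram error. -/
theorem sum_pull_inner_sq_ge (hM : ∀ᵐ x ∂P, ‖x‖ ≤ M)
    (hs : ∀ v, s₀ * ‖v‖ ^ 2 ≤ ∫ x, inner ℝ v x ^ 2 ∂P)
    (hπ : 0 < πmin) (hK : (K : ℝ) * πmin ≤ 1) (a : Fin K) {t : ℕ} (ht : 0 < t) (ω : Ω)
    (v : Context d) :
    (t * (πmin * s₀) - t * gramError P (ridgeBoltzmannPolicy d K lam πmin γ) X Ypot A a t ω) *
      ‖v‖ ^ 2 ≤ ∑ s ∈ Finset.range t, pull A a s ω * inner ℝ v (X s ω) ^ 2 := by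
  set π := ridgeBoltzmannPolicy d K lam πmin γ with hπdef
  have ht' : (0 : ℝ) < t := by exact_mod_cast ht
  let w : ℕ → Context d → ℝ := fun s x =>
    clippedBoltzmann πmin γ (ridge lam (history X Ypot A s ω)) x a
  have hw : ∀ s, Measurable (w s) := fun s => measurable_clippedBoltzmann hK _ a
  have hwp : ∀ s x, πmin ≤ w s x := fun s x => le_clip _ _ _
  have hw1 : ∀ s x, w s x ≤ 1 := fun s x => clippedBoltzmann_le_one hπ.le hK _ x a
  have e : ∑ s ∈ Finset.range t, pull A a s ω * inner ℝ v (X s ω) ^ 2 =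
      ∑ s ∈ Finset.range t, ∫ x, w s x * inner ℝ v x ^ 2 ∂P +
      ∑ i, ∑ j, v i * v j * (t * armError P π X Ypot A a (fun x => x i * x j) t ω) := by
    have e1 : ∀ s ∈ Finset.range t, pull A a s ω * inner ℝ v (X s ω) ^ 2 =
        ∫ x, w s x * inner ℝ v x ^ 2 ∂P + ∑ i, ∑ j, v i * v j *
          (pull A a s ω * (X s ω i * X s ω j) -
            policyMean P π a (fun x => x i * x j) s (history X Ypot A s ω)) := by
      intro s _
      rw [integral_weight_inner_sq hM (hw s) (fun x => hπ.le.trans (hwp s x)) (hw1 s),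
        inner_sq_eq_sum, Finset.mul_sum, ← Finset.sum_add_distrib]
      refine Finset.sum_congr rfl fun i _ => ?_
      rw [Finset.mul_sum, ← Finset.sum_add_distrib]
      refine Finset.sum_congr rfl fun j _ => ?_
      have : policyMean P π a (fun x => x i * x j) s (history X Ypot A s ω) =
        ∫ x, w s x * (x i * x j) ∂P := rfl
      rw [this]
      ring
    rw [Finset.sum_congr rfl e1, Finset.sum_add_distrib]
    congr 1
    rw [Finset.sum_comm]
    refine Finset.sum_congr rfl fun i _ => ?_
    rw [Finset.sum_comm]
    refine Finset.sum_congr rfl fun j _ => ?_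
    rw [armError, mul_div_cancel₀ _ ht'.ne', Finset.mul_sum]
  have h1 : (t : ℝ) * (πmin * s₀ * ‖v‖ ^ 2) ≤
      ∑ s ∈ Finset.range t, ∫ x, w s x * inner ℝ v x ^ 2 ∂P := by
    calc (t : ℝ) * (πmin * s₀ * ‖v‖ ^ 2) =
        ∑ s ∈ Finset.range t, πmin * s₀ * ‖v‖ ^ 2 := by simp
      _ ≤ _ := Finset.sum_le_sum fun s _ =>
        sq_norm_le_integral_weight hM hs hπ.le (hw s) (hwp s) (hw1 s) v
  have h2 := abs_sum_sum_mul_le v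
    (fun i j => t * armError P π X Ypot A a (fun x => x i * x j) t ω)
  have h3 : ∑ i, ∑ j, |t * armError P π X Ypot A a (fun x => x i * x j) t ω| =
      t * gramError P π X Ypot A a t ω := by
    simp_rw [gramError, Finset.mul_sum, abs_mul, abs_of_pos ht']
  rw [h3] at h2
  have h4 := (abs_le.1 h2).1
  rw [e]
  linarith

/-- The residual of a round splits into noise, the centred fluctuation of the action and context,
and the score at `θ` under the policy of that round. -/
theorem norm_residual_le (hM : ∀ᵐ x ∂P, ‖x‖ ≤ M)
    (hπ : 0 < πmin) (hK : (K : ℝ) * πmin ≤ 1)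
    (hym : ∀ a, Measurable fun x => y x a) (hy : ∀ x a, ‖x‖ ≤ M → |y x a| ≤ Ry) (hlam : 0 < lam)
    (a : Fin K) {t : ℕ} (ht : 0 < t) (ω : Ω) (θ : Context d) :
    ‖-(lam • θ) + ∑ s ∈ Finset.range t, pull A a s ω •
        ((outcome Ypot A s ω - inner ℝ θ (X s ω)) • X s ω)‖ ≤
      (lam * ‖θ‖ + t * crossError P (ridgeBoltzmannPolicy d K lam πmin γ) y X Ypot A a θ t ω) +
        ∑ s ∈ Finset.range t, ‖score P
          (fun x => clippedBoltzmann πmin γ (ridge lam (history X Ypot A s ω)) x a)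
          (fun x => y x a) θ‖ := by
  set π := ridgeBoltzmannPolicy d K lam πmin γ with hπdef
  have ht' : (0 : ℝ) < t := by exact_mod_cast ht
  let w : ℕ → Context d → ℝ := fun s x =>
    clippedBoltzmann πmin γ (ridge lam (history X Ypot A s ω)) x a
  have hw : ∀ s, Measurable (w s) := fun s => measurable_clippedBoltzmann hK _ a
  have hwp : ∀ s x, πmin ≤ w s x := fun s x => le_clip _ _ _
  have hw1 : ∀ s x, w s x ≤ 1 := fun s x => clippedBoltzmann_le_one hπ.le hK _ x a
  set D := ∑ s ∈ Finset.range t, (pull A a s ω •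
    ((outcome Ypot A s ω - inner ℝ θ (X s ω)) • X s ω) - score P (w s) (fun x => y x a) θ)
    with hD
  have hDi : ∀ i, D i = t * noiseError y X Ypot A a (fun x => x i) t ω +
      t * armError P π X Ypot A a (fun x => x i * (y x a - inner ℝ θ x)) t ω := by
    intro i
    rw [noiseError, armError, mul_div_cancel₀ _ ht'.ne', mul_div_cancel₀ _ ht'.ne',
      ← Finset.sum_add_distrib, hD]
    simp only [WithLp.ofLp_sum, Finset.sum_apply, PiLp.sub_apply, PiLp.smul_apply, smul_eq_mul]
    refine Finset.sum_congr rfl fun s _ => ?_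
    rw [score_apply hM (hw s) (fun x => hπ.le.trans (hwp s x)) (hw1 s) (hym a)
      (fun x => hy x a)]
    have e1 : policyMean P π a (fun x => x i * (y x a - inner ℝ θ x)) s (history X Ypot A s ω) =
        ∫ x, w s x * (x i * (y x a - inner ℝ θ x)) ∂P := rfl
    -- On rounds that choose `a`, the noise is measured from `y (X s ω) a`.
    have e2 : pull A a s ω * noise y X Ypot A s ω =
        pull A a s ω * (outcome Ypot A s ω - y (X s ω) a) := by
      unfold pull
      split_ifs with h
      · rw [noise, h]
      · simp
    have e3 : pull A a s ω * X s ω i * noise y X Ypot A s ω =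
        pull A a s ω * (outcome Ypot A s ω - y (X s ω) a) * X s ω i := by
      rw [← e2]
      ring
    rw [e1, e3]
    ring
  have hDn : ‖D‖ ≤ t * crossError P π y X Ypot A a θ t ω := by
    refine (norm_le_sum_abs D).trans ?_
    rw [crossError, Finset.mul_sum]
    refine Finset.sum_le_sum fun i _ => ?_
    rw [hDi, ← mul_add, abs_mul, abs_of_pos ht']
    gcongr
    exact abs_add_le _ _
  have e : -(lam • θ) + ∑ s ∈ Finset.range t, pull A a s ω •
      ((outcome Ypot A s ω - inner ℝ θ (X s ω)) • X s ω) =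
      (-(lam • θ) + D) + ∑ s ∈ Finset.range t, score P (w s) (fun x => y x a) θ := by
    rw [hD, Finset.sum_sub_distrib]
    abel
  rw [e]
  refine (norm_add_le _ _).trans (add_le_add ((norm_add_le _ _).trans (add_le_add ?_ hDn))
    (norm_sum_le _ _))
  rw [norm_neg, norm_smul, Real.norm_of_nonneg hlam.le]

/-- The recursive inequality for the truncated estimation error. -/
theorem min_norm_ridge_sub_le (hM : ∀ᵐ x ∂P, ‖x‖ ≤ M) (hM0 : 0 < M)
    (hs : ∀ v, s₀ * ‖v‖ ^ 2 ≤ ∫ x, inner ℝ v x ^ 2 ∂P) (hs0 : 0 < s₀) (hRy : 0 < Ry)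
    (hπ : 0 < πmin) (hK : (K : ℝ) * πmin ≤ 1) (hγ : 32 * M ^ 4 * Ry / (πmin * s₀) ^ 2 ≤ γ)
    (hym : ∀ a, Measurable fun x => y x a) (hy : ∀ x a, ‖x‖ ≤ M → |y x a| ≤ Ry) (hlam : 0 < lam)
    {β : Fin K → Context d} (hβ : ∀ a,
      score P (fun x => clippedBoltzmann πmin γ β x a) (fun x => y x a) (β a) = 0)
    {t : ℕ} (ht : 0 < t) (ω : Ω) :
    min ‖ridge lam (history X Ypot A t ω) - β‖ (γ / (4 * M)) ≤
      1 / 2 * ((∑ s ∈ Finset.range t,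
        min ‖ridge lam (history X Ypot A s ω) - β‖ (γ / (4 * M))) / t) +
      ∑ a, (2 / (πmin * s₀) * (lam * ‖β a‖ / t +
          crossError P (ridgeBoltzmannPolicy d K lam πmin γ) y X Ypot A a (β a) t ω) +
        2 * (γ / (4 * M)) / (πmin * s₀) *
          gramError P (ridgeBoltzmannPolicy d K lam πmin γ) X Ypot A a t ω) := by
  have hγ0 : 0 < γ := lt_of_lt_of_le (by positivity) hγ
  have ht' : (0 : ℝ) < t := by exact_mod_cast ht
  set S := ∑ s ∈ Finset.range t,
    min ‖ridge lam (history X Ypot A s ω) - β‖ (γ / (4 * M)) with hS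
  have hS0 : 0 ≤ S := Finset.sum_nonneg fun s _ => le_min (norm_nonneg _) (by positivity)
  have hG0 : ∀ a, 0 ≤ gramError P (ridgeBoltzmannPolicy d K lam πmin γ) X Ypot A a t ω :=
    fun a => Finset.sum_nonneg fun i _ => Finset.sum_nonneg fun j _ => abs_nonneg _
  have hC0 : ∀ a, 0 ≤
      crossError P (ridgeBoltzmannPolicy d K lam πmin γ) y X Ypot A a (β a) t ω :=
    fun a => Finset.sum_nonneg fun i _ => by positivity
  have hE0 : ∀ a, 0 ≤ 2 / (πmin * s₀) * (lam * ‖β a‖ / t +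
      crossError P (ridgeBoltzmannPolicy d K lam πmin γ) y X Ypot A a (β a) t ω) +
      2 * (γ / (4 * M)) / (πmin * s₀) *
        gramError P (ridgeBoltzmannPolicy d K lam πmin γ) X Ypot A a t ω := by
    intro a
    have := hG0 a
    have := hC0 a
    positivity
  -- The sup norm reduces the claim to one action; the nonnegative error terms of the other actions
  -- are added for free.
  refine min_norm_pi_le (add_nonneg (by positivity) (Finset.sum_nonneg fun a _ => hE0 a))
    fun a => ?_
  refine le_trans ?_ (add_le_add le_rfl
    (Finset.single_le_sum (fun b _ => hE0 b) (Finset.mem_univ a)))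
  rw [Pi.sub_apply]
  set e := ridge lam (history X Ypot A t ω) a - β a with he
  have hkey : (t * (πmin * s₀) -
      t * gramError P (ridgeBoltzmannPolicy d K lam πmin γ) X Ypot A a t ω) * ‖e‖ ≤
      (lam * ‖β a‖ +
        t * crossError P (ridgeBoltzmannPolicy d K lam πmin γ) y X Ypot A a (β a) t ω) +
      πmin * s₀ / 4 * S := by
    have h1 := sum_pull_inner_sq_ge (X := X) (Ypot := Ypot) (A := A) (lam := lam) (γ := γ)
      hM hs hπ hK a ht ω e
    have h2 := norm_residual_le (X := X) (Ypot := Ypot) (A := A) (lam := lam) (γ := γ)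
      hM hπ hK hym hy hlam a ht ω (β a)
    have h3 := ridge_error_equation hlam (history X Ypot A t ω) a (β a)
    rw [← he] at h3
    have h4 : lam * ‖e‖ ^ 2 + ∑ s ∈ Finset.range t, pull A a s ω * inner ℝ e (X s ω) ^ 2 =
        inner ℝ e (-(lam • β a) + ∑ s ∈ Finset.range t, pull A a s ω •
          ((outcome Ypot A s ω - inner ℝ (β a) (X s ω)) • X s ω)) := by
      rw [Finset.sum_range, Finset.sum_range]
      exact h3
    have h5 := real_inner_le_norm e (-(lam • β a) + ∑ s ∈ Finset.range t, pull A a s ω •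
          ((outcome Ypot A s ω - inner ℝ (β a) (X s ω)) • X s ω))
    have h6 : ∑ s ∈ Finset.range t, ‖score P
          (fun x => clippedBoltzmann πmin γ (ridge lam (history X Ypot A s ω)) x a)
          (fun x => y x a) (β a)‖ ≤ πmin * s₀ / 4 * S := by
      rw [hS, Finset.mul_sum]
      exact Finset.sum_le_sum fun s _ => norm_score_le_quarter hM hM0 hs hs0 hRy hπ hK hγ hym hy
        _ β a (hβ a)
    have h7 := h2.trans (add_le_add le_rfl h6)
    -- The penalty term is dropped, and one factor `‖e‖` is cancelled after Cauchy–Schwarz.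
    have h8 : 0 ≤ lam * ‖e‖ ^ 2 := by positivity
    rcases (norm_nonneg e).eq_or_lt with h0 | h0
    · rw [← h0, mul_zero]
      have := hC0 a
      positivity
    · refine le_of_mul_le_mul_right ?_ h0
      have h9 := mul_le_mul_of_nonneg_left h7 h0.le
      nlinarith
  have h := min_le_half_average (by positivity : 0 < πmin * s₀) ht' (norm_nonneg e)
    (by positivity : 0 ≤ γ / (4 * M)) (mul_nonneg ht'.le (hG0 a))
    (add_nonneg (by positivity) (mul_nonneg ht'.le (hC0 a))) hS0 hkey
  rwa [mul_div_cancel_left₀ _ ht'.ne', add_div, mul_div_cancel_left₀ _ ht'.ne'] at h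

end Main

end

/-! ### Convergence -/

section Convergence

variable {Ω : Type*} [MeasurableSpace Ω] {μ : Measure Ω} {d K : ℕ}
  {X : ℕ → Ω → Context d} {Ypot : ℕ → Ω → Fin K → ℝ} {A : ℕ → Ω → Fin K}
  {y : Context d → Fin K → ℝ} {M σmin Ry ση lam πmin γ : ℝ}

/-- By the Lipschitz bound, a deviation `ε` of the policy forces a deviation `ε * (γ / (4 * M))` of
the estimator. -/
theorem policyConverges_of_tendstoInMeasure_ridge [NeZero K] (hM : 0 < M) (hπ : 0 ≤ πmin)
    (hK : (K : ℝ) * πmin ≤ 1) (hγ : 0 < γ) (hX : ∀ t, ∀ᵐ ω ∂μ, ‖X t ω‖ ≤ M)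
    {β : Fin K → Context d} (h : TendstoInMeasure μ
      (fun t ω => ridge lam (history X Ypot A t ω)) atTop (fun _ => β)) :
    PolicyConverges μ (ridgeBoltzmannPolicy d K lam πmin γ) X Ypot A := by
  refine ⟨clippedBoltzmann πmin γ β, measurable_pi_lambda _ fun a =>
    measurable_clippedBoltzmann hK β a, clippedBoltzmann_mem_stdSimplex hπ hK β, fun a => ?_⟩
  rw [tendstoInMeasure_iff_norm] at h ⊢
  intro ε hε
  refine tendsto_of_tendsto_of_tendsto_of_le_of_le tendsto_const_nhds
    (h (ε * (γ / (4 * M))) (by positivity)) (fun t => zero_le) fun t => ?_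
  refine measure_mono_ae ?_
  filter_upwards [hX t] with ω hω hε'
  have h1 : ε ≤ |clippedBoltzmann πmin γ (ridge lam (history X Ypot A t ω)) (X t ω) a -
      clippedBoltzmann πmin γ β (X t ω) a| := by
    have h0 : ε ≤ ‖ridgeBoltzmannPolicy d K lam πmin γ t (history X Ypot A t ω) (X t ω) a -
      clippedBoltzmann πmin γ β (X t ω) a - 0‖ := hε'
    rwa [sub_zero] at h0
  have h2 := h1.trans (abs_clippedBoltzmann_sub_le hγ hK _ β (X t ω) a)
  have h3 : ε ≤ 4 * M / γ * ‖ridge lam (history X Ypot A t ω) - β‖ := h2.trans (by gcongr)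
  have h4 : ε * (γ / (4 * M)) ≤ ‖ridge lam (history X Ypot A t ω) - β‖ := by
    rw [← mul_div_assoc, div_le_iff₀ (by positivity)]
    rw [div_mul_eq_mul_div, le_div_iff₀ hγ] at h3
    linarith
  exact h4

variable [IsProbabilityMeasure μ]

theorem IsRegular.second_moment_le {π : BehaviorPolicy d K} (hdata : IsBanditData μ π X Ypot A)
    (hreg : IsRegular μ X Ypot A y M σmin Ry ση)
    (hM : ∀ᵐ x ∂(μ.map (X 0)), ‖x‖ ≤ M) (v : Context d) :
    σmin ^ 2 * ‖v‖ ^ 2 ≤ ∫ x, inner ℝ v x ^ 2 ∂(μ.map (X 0)) := by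
  have hX := hdata.measurable_context 0
  have : IsProbabilityMeasure (μ.map (X 0)) := Measure.isProbabilityMeasure_map hX.aemeasurable
  have h1 := integral_weight_inner_sq hM (w := fun _ => 1) measurable_const (by simp) (by simp) v
  simp only [one_mul] at h1
  have h2 : ∀ i j, ∫ x, x i * x j ∂(μ.map (X 0)) = ∫ ω, X 0 ω i * X 0 ω j ∂μ := fun i j =>
    integral_map hX.aemeasurable (Measurable.aestronglyMeasurable (by fun_prop))
  have h3 := (hreg.second_moment 0).dotProduct_mulVec_nonneg (WithLp.ofLp v)
  rw [Matrix.sub_mulVec, dotProduct_sub, Matrix.smul_mulVec, Matrix.one_mulVec,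
    dotProduct_smul, smul_eq_mul] at h3
  have h4 : star (WithLp.ofLp v) ⬝ᵥ WithLp.ofLp v = ‖v‖ ^ 2 := by
    rw [EuclideanSpace.norm_sq_eq]
    simp [dotProduct, sq]
  have h5 : star (WithLp.ofLp v) ⬝ᵥ (Matrix.of (fun i j : Fin d =>
      ∫ ω, X 0 ω i * X 0 ω j ∂μ)).mulVec (WithLp.ofLp v) =
      ∑ i, ∑ j, v i * v j * ∫ ω, X 0 ω i * X 0 ω j ∂μ := by
    simp only [dotProduct, Matrix.mulVec, Matrix.of_apply, Finset.mul_sum]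
    refine Finset.sum_congr rfl fun i _ => Finset.sum_congr rfl fun j _ => ?_
    simp only [Pi.star_apply, star_trivial]
    ring
  rw [h4, h5] at h3
  simp_rw [h1, h2]
  linarith

/-- From the second entry of the maximum and `K * (K + 1) ≥ 2`, since `2 * 8 * 2 = 32`. -/
theorem temperature_bound (hM : 0 < M) (hσ : 0 < σmin) (hRy : 0 < Ry) (hση : 0 < ση)
    (hπ : 0 < πmin) [NeZero K]
    (hγ : 2 * M ^ 3 * max (2 / (πmin * σmin ^ 2))
          (8 * (M * Ry + 4 * M * ση * Real.sqrt ((d : ℝ) * (K : ℝ))) / (πmin ^ 2 * σmin ^ 4)) *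
        ((K : ℝ) * ((K : ℝ) + 1)) ≤ γ) :
    32 * M ^ 4 * Ry / (πmin * σmin ^ 2) ^ 2 ≤ γ := by
  have hK : (1 : ℝ) ≤ K := by exact_mod_cast NeZero.one_le
  have hKK : (2 : ℝ) ≤ K * (K + 1) := by nlinarith
  refine le_trans ?_ hγ
  have h1 : 8 * (M * Ry) / (πmin ^ 2 * σmin ^ 4) ≤ max (2 / (πmin * σmin ^ 2))
      (8 * (M * Ry + 4 * M * ση * Real.sqrt ((d : ℝ) * (K : ℝ))) / (πmin ^ 2 * σmin ^ 4)) := by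
    refine le_trans ?_ (le_max_right _ _)
    gcongr
    have : 0 ≤ 4 * M * ση * Real.sqrt ((d : ℝ) * (K : ℝ)) := by positivity
    linarith
  calc 32 * M ^ 4 * Ry / (πmin * σmin ^ 2) ^ 2
      = 2 * M ^ 3 * (8 * (M * Ry) / (πmin ^ 2 * σmin ^ 4)) * 2 := by
        field_simp
        ring
    _ ≤ _ := by gcongr

theorem IsBanditData.tendstoZeroInMean_gramError {π : BehaviorPolicy d K}
    (hdata : IsBanditData μ π X Ypot A) (hM : ∀ᵐ x ∂(μ.map (X 0)), ‖x‖ ≤ M)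
    (hπm : ∀ t a, Measurable fun z : History d K t × Context d => π t z.1 z.2 a)
    (hπ0 : ∀ t h x a, 0 ≤ π t h x a) (hπ1 : ∀ t h x a, π t h x a ≤ 1) (a : Fin K) :
    TendstoZeroInMean μ (gramError (μ.map (X 0)) π X Ypot A a) := by
  have key : ∀ i j, TendstoZeroInMean μ
      (armError (μ.map (X 0)) π X Ypot A a (fun x => x i * x j)) := by
    intro i j
    refine hdata.tendstoZeroInMean_average (f := fun x => x i * x j) (fun t => hπm t a)
      (fun t h x => hπ0 t h x a) (fun t h x => hπ1 t h x a) (by fun_prop) (C := M * M) ?_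
    filter_upwards [hM] with x hx
    have h1 := (abs_apply_le_norm x i).trans hx
    have h2 := (abs_apply_le_norm x j).trans hx
    have hM0 := (norm_nonneg x).trans hx
    rw [abs_mul]
    gcongr
  exact TendstoZeroInMean.sum (ξ := fun i t ω => ∑ j, |armError (μ.map (X 0)) π X Ypot A a
    (fun x => x i * x j) t ω|) _ fun i => TendstoZeroInMean.sum (ξ := fun j t ω =>
      |armError (μ.map (X 0)) π X Ypot A a (fun x => x i * x j) t ω|) _ fun j => (key i j).abs

theorem IsBanditData.tendstoZeroInMean_crossError {π : BehaviorPolicy d K}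
    (hdata : IsBanditData μ π X Ypot A) (hreg : IsRegular μ X Ypot A y M σmin Ry ση)
    (hM : ∀ᵐ x ∂(μ.map (X 0)), ‖x‖ ≤ M)
    (hπm : ∀ t a, Measurable fun z : History d K t × Context d => π t z.1 z.2 a)
    (hπ0 : ∀ t h x a, 0 ≤ π t h x a) (hπ1 : ∀ t h x a, π t h x a ≤ 1) (a : Fin K)
    (θ : Context d) :
    TendstoZeroInMean μ (crossError (μ.map (X 0)) π y X Ypot A a θ) := by
  have key1 : ∀ i, TendstoZeroInMean μ (noiseError y X Ypot A a (fun x => x i)) := by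
    intro i
    refine hdata.tendstoZeroInMean_average_noise hreg.measurable_mean hreg.noise_memLp
      hreg.noise_mean hreg.noise_variance a (f := fun x => x i) (by fun_prop) (C := M) ?_
    filter_upwards [hM] with x hx
    exact (abs_apply_le_norm x i).trans hx
  have key2 : ∀ i, TendstoZeroInMean μ
      (armError (μ.map (X 0)) π X Ypot A a (fun x => x i * (y x a - inner ℝ θ x))) := by
    intro i
    have := hreg.measurable_mean a
    refine hdata.tendstoZeroInMean_average (f := fun x => x i * (y x a - inner ℝ θ x))
      (fun t => hπm t a) (fun t h x => hπ0 t h x a)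
      (fun t h x => hπ1 t h x a) (by fun_prop) (C := M * (Ry + ‖θ‖ * M)) ?_
    filter_upwards [hM] with x hx
    have h1 := (abs_apply_le_norm x i).trans hx
    have h2 := abs_sub_inner_le (f := fun x => y x a) (θ := θ)
      (fun x => hreg.mean_bound x a) hx
    have hM0 := (norm_nonneg x).trans hx
    rw [abs_mul]
    gcongr
  exact TendstoZeroInMean.sum (ξ := fun i t ω => |noiseError y X Ypot A a (fun x => x i) t ω| +
    |armError (μ.map (X 0)) π X Ypot A a (fun x => x i * (y x a - inner ℝ θ x)) t ω|) _
    fun i => (key1 i).abs.add (key2 i).abs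

/-- Markov's inequality at level `min ε B`, which the truncated error reaches whenever the error
reaches `ε`. -/
theorem tendstoInMeasure_of_tendsto_integral_min {E : Type*} [SeminormedAddCommGroup E]
    {f : ℕ → Ω → E} {g : E} {B : ℝ} (hB : 0 < B)
    (hint : ∀ t, Integrable (fun ω => min ‖f t ω - g‖ B) μ)
    (h : Tendsto (fun t => ∫ ω, min ‖f t ω - g‖ B ∂μ) atTop (nhds 0)) :
    TendstoInMeasure μ f atTop fun _ => g := by
  rw [tendstoInMeasure_iff_norm]
  intro ε hε
  have hm : 0 < min ε B := lt_min hε hB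
  have hreal : Tendsto (fun t => μ.real {ω | ε ≤ ‖f t ω - g‖}) atTop (nhds 0) := by
    refine squeeze_zero (fun t => measureReal_nonneg) (fun t => ?_)
      (by simpa using h.const_mul (min ε B)⁻¹)
    have h1 := mul_meas_ge_le_integral_of_nonneg (μ := μ)
      (.of_forall fun ω => le_min (norm_nonneg (f t ω - g)) hB.le) (hint t) (min ε B)
    rw [inv_mul_eq_div, le_div_iff₀ hm, mul_comm]
    refine le_trans ?_ h1
    exact mul_le_mul_of_nonneg_left
      (measureReal_mono fun ω hω => min_le_min_right B hω) hm.le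
  have h2 := ENNReal.tendsto_ofReal hreal
  simpa using h2

variable [NeZero K]

theorem measurable_ridgeBoltzmannPolicy (hK : (K : ℝ) * πmin ≤ 1) (t : ℕ) (a : Fin K) :
    Measurable fun z : History d K t × Context d =>
      ridgeBoltzmannPolicy d K lam πmin γ t z.1 z.2 a := by
  have h1 : Measurable fun z : (Fin K → Context d) × Context d =>
      clippedBoltzmann πmin γ z.1 z.2 a := (continuous_clippedBoltzmann hK a).measurable
  have h2 : Measurable fun z : History d K t × Context d => (ridge lam z.1, z.2) :=
    ((measurable_ridge lam).comp measurable_fst).prodMk measurable_snd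
  simpa only [ridgeBoltzmannPolicy, Function.comp_def] using h1.comp h2

theorem exists_tendstoInMeasure_ridge (hM : 0 < M) (hσmin : 0 < σmin) (hRy : 0 < Ry)
    (hlam : 0 < lam) (hπ : 0 < πmin) (hK : (K : ℝ) * πmin ≤ 1)
    (hdata : IsBanditData μ (ridgeBoltzmannPolicy d K lam πmin γ) X Ypot A)
    (hreg : IsRegular μ X Ypot A y M σmin Ry ση)
    (hγ : 32 * M ^ 4 * Ry / (πmin * σmin ^ 2) ^ 2 ≤ γ) :
    ∃ β : Fin K → Context d, TendstoInMeasure μ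
      (fun t ω => ridge lam (history X Ypot A t ω)) atTop (fun _ => β) := by
  have hγ0 : 0 < γ := lt_of_lt_of_le (by positivity) hγ
  have hX := hdata.measurable_context 0
  have : IsProbabilityMeasure (μ.map (X 0)) := Measure.isProbabilityMeasure_map hX.aemeasurable
  have hMP : ∀ᵐ x ∂(μ.map (X 0)), ‖x‖ ≤ M :=
    (ae_map_iff hX.aemeasurable (measurableSet_le (by fun_prop) measurable_const)).2
      (hreg.context_bound 0)
  have hs := hreg.second_moment_le hdata hMP
  have hs0 : 0 < σmin ^ 2 := by positivity
  obtain ⟨β, hβ⟩ := exists_fixedPoint hMP hM hs hs0 hRy hπ hK hγ hreg.measurable_mean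
    hreg.mean_bound
  have hπm : ∀ t a, Measurable fun z : History d K t × Context d =>
      ridgeBoltzmannPolicy d K lam πmin γ t z.1 z.2 a := fun t a =>
    measurable_ridgeBoltzmannPolicy hK t a
  have hπ0 : ∀ t h x a, 0 ≤ ridgeBoltzmannPolicy d K lam πmin γ t h x a := fun t h x a =>
    hπ.le.trans (le_clip _ _ _)
  have hπ1 : ∀ t h x a, ridgeBoltzmannPolicy d K lam πmin γ t h x a ≤ 1 := fun t h x a =>
    clippedBoltzmann_le_one hπ.le hK _ _ _
  set B := γ / (4 * M) with hBdef
  have hB : 0 < B := by positivity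
  have hWm : ∀ t, Measurable fun ω => min ‖ridge lam (history X Ypot A t ω) - β‖ B := fun t =>
    ((((measurable_ridge lam).comp (hdata.measurable_history t)).sub_const β).norm).min
      measurable_const
  have hW0 : ∀ t ω, 0 ≤ min ‖ridge lam (history X Ypot A t ω) - β‖ B := fun t ω =>
    le_min (norm_nonneg _) hB.le
  have hWi : ∀ t, Integrable (fun ω => min ‖ridge lam (history X Ypot A t ω) - β‖ B) μ :=
    fun t => Integrable.of_bound (hWm t).aestronglyMeasurable B (.of_forall fun ω => by
      rw [Real.norm_of_nonneg (hW0 t ω)]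
      exact min_le_right _ _)
  have herr : TendstoZeroInMean μ fun t ω => ∑ a, (2 / (πmin * σmin ^ 2) * (lam * ‖β a‖ / t +
      crossError (μ.map (X 0)) (ridgeBoltzmannPolicy d K lam πmin γ) y X Ypot A a (β a) t ω) +
      2 * B / (πmin * σmin ^ 2) *
        gramError (μ.map (X 0)) (ridgeBoltzmannPolicy d K lam πmin γ) X Ypot A a t ω) := by
    refine TendstoZeroInMean.sum (ξ := fun a t ω => 2 / (πmin * σmin ^ 2) * (lam * ‖β a‖ / t +
      crossError (μ.map (X 0)) (ridgeBoltzmannPolicy d K lam πmin γ) y X Ypot A a (β a) t ω) +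
      2 * B / (πmin * σmin ^ 2) *
        gramError (μ.map (X 0)) (ridgeBoltzmannPolicy d K lam πmin γ) X Ypot A a t ω) _
      fun a => ?_
    have h1 : TendstoZeroInMean μ fun t _ => lam * ‖β a‖ / t :=
      TendstoZeroInMean.const (tendsto_const_div_atTop_nhds_zero_nat _)
    have h2 := hdata.tendstoZeroInMean_crossError hreg hMP hπm hπ0 hπ1 a (β a)
    have h3 := hdata.tendstoZeroInMean_gramError hMP hπm hπ0 hπ1 a
    exact ((h1.add h2).const_mul _).add (h3.const_mul _)
  refine ⟨β, tendstoInMeasure_of_tendsto_integral_min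
    (f := fun t ω => ridge lam (history X Ypot A t ω)) (g := β) hB hWi ?_⟩
  -- The pathwise recursion is integrated, so that the half-average lemma applies to the expected
  -- truncated errors.
  refine tendsto_zero_of_le_half_average (B := B)
    (w := fun t => ∫ ω, min ‖ridge lam (history X Ypot A t ω) - β‖ B ∂μ) (fun t => integral_nonneg (hW0 t))
    (fun t => ?_) herr.tendsto_integral fun t ht => ?_
  · refine (integral_mono (hWi t) (integrable_const B) fun ω => min_le_right _ _).trans ?_
    simp
  · have hsum : Integrable (fun ω => 1 / 2 * ((∑ s ∈ Finset.range t,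
        min ‖ridge lam (history X Ypot A s ω) - β‖ B) / t)) μ :=
      ((integrable_finsetSum _ fun s _ => hWi s).div_const _).const_mul _
    refine (integral_mono (hWi t) (hsum.add (herr.1 t)) fun ω =>
      min_norm_ridge_sub_le hMP hM hs hs0 hRy hπ hK hγ hreg.measurable_mean hreg.mean_bound hlam
        hβ ht ω).trans (le_of_eq ?_)
    simp only [Pi.add_apply]
    rw [integral_add hsum (herr.1 t), integral_const_mul, integral_div,
      integral_finsetSum _ fun s _ => hWi s]

end Convergence

end ContextualBandit

theorem proposition4 {Ω : Type*} [MeasurableSpace Ω] (μ : MeasureTheory.Measure Ω)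
    [MeasureTheory.IsProbabilityMeasure μ] (d K : ℕ)
    (X : ℕ → Ω → ContextualBandit.Context d) (Ypot : ℕ → Ω → Fin K → ℝ) (A : ℕ → Ω → Fin K)
    (y : ContextualBandit.Context d → Fin K → ℝ)
    (M σmin Ry ση lam πmin γ : ℝ)
    (hM : 0 < M) (hσmin : 0 < σmin) (hRy : 0 < Ry) (hση : 0 < ση) (hlam : 0 < lam)
    (hπmin : 0 < πmin) (hπmin1 : πmin < 1) (hKπmin : (K : ℝ) * πmin ≤ 1)
    (hdata : ContextualBandit.IsBanditData μ
      (ContextualBandit.ridgeBoltzmannPolicy d K lam πmin γ) X Ypot A)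
    (hreg : ContextualBandit.IsRegular μ X Ypot A y M σmin Ry ση)
    (hγ : 2 * M ^ 3 *
        max (2 / (πmin * σmin ^ 2))
          (8 * (M * Ry + 4 * M * ση * Real.sqrt ((d : ℝ) * (K : ℝ))) /
            (πmin ^ 2 * σmin ^ 4)) *
        ((K : ℝ) * ((K : ℝ) + 1)) ≤ γ) :
    (∃ βbar : Fin K → ContextualBandit.Context d,
      MeasureTheory.TendstoInMeasure μ
        (fun t ω => ContextualBandit.ridge lam (ContextualBandit.history X Ypot A t ω))
        Filter.atTop (fun _ => βbar)) ∧
    ContextualBandit.PolicyConverges μ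
      (ContextualBandit.ridgeBoltzmannPolicy d K lam πmin γ) X Ypot A := by
  obtain ⟨ω⟩ : Nonempty Ω := μ.nonempty_of_neZero
  have : NeZero K := ⟨by
    rintro rfl
    exact (A 0 ω).elim0⟩
  have hγ' := ContextualBandit.temperature_bound (d := d) hM hσmin hRy hση hπmin hγ
  have hγ0 : 0 < γ := lt_of_lt_of_le (by positivity) hγ'
  obtain ⟨β, hβ⟩ := ContextualBandit.exists_tendstoInMeasure_ridge hM hσmin hRy hlam hπmin hKπmin
    hdata hreg hγ'
  exact ⟨⟨β, hβ⟩, ContextualBandit.policyConverges_of_tendstoInMeasure_ridge hM hπmin.le hKπmin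
    hγ0 hreg.context_bound hβ⟩
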